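/- Asymptotic dimension: for a metric space $X$, $\operatorname{asdim}X\le n$ means that every uniformly bounded open cover $\mathcal V$ of $X$ refines a uniformly bounded open cover $\mathcal U$ of $X$ in which every point lies in at most $n+1$ members; $\operatorname{asdim}X$ is the least such $n$ (and $\infty$ if there is none). For a group $\Gamma$ with a finite symmetric generating set $S$, $\operatorname{asdim}\Gamma$ is taken with respect to the left-invariant word metric $d_S(g,h)=\|g^{-1}h\|_S$. Hirsch length: a group $\Gamma$ is polycyclic if it has a finite series $1=\Gamma_0\lhd\Gamma_1\lhd\dots\lhd\Gamma_n=\Gamma$ with cyclic quotients, and then $h(\Gamma)=\sum_i\operatorname{rk}(\Gamma_{i+1}/\Gamma_i)$ is the number of infinite cyclic quotients, which does not depend on the series. For a connected nilpotent Lie group $N$, take a central series $1=\Gamma_0\le\Gamma_1\le\dots\le\Gamma_n=N$ of closed connected normal subgroups; each $\Gamma_{i+1}/\Gamma_i$ is a connected abelian Lie group, $\Gamma_{i+1}/\Gamma_i\cong\mathbb R^{a_i}\times\mathbb T^{b_i}$, and $h(N)=\sum_i a_i$, which does not depend on the series. Theorem. (1) Let $\Gamma$ be a finitely generated polycyclic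 group. Then $\operatorname{asdim}\Gamma\le h(\Gamma)$, for the word metric of every finite symmetric generating set. (2) Let $\Gamma$ be a finitely generated nilpotent group. Then $\Gamma$ is polycyclic and $\operatorname{asdim}\Gamma\le h(\Gamma)$, for the word metric of every finite symmetric generating set. (3) Let $N$ be a connected nilpotent Lie group endowed with an equivariant metric, that is, a left-invariant metric which induces the topology of $N$ and is proper (closed balls are compact), for instance the distance of a left-invariant Riemannian metric. Then $N$ has a central series of closed connected normal subgroups, and $\operatorname{asdim}N\le h(N)$. -/

import Mathlib

open scoped Manifold ContDiff

noncomputable section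

/-! ### Asymptotic dimension -/

/-- The family `𝒰` covers `X` by open sets of uniformly bounded diameter. -/
def IsUniformlyBoundedOpenCover {X : Type*} [PseudoMetricSpace X] (𝒰 : Set (Set X)) : Prop :=
  (∀ U ∈ 𝒰, IsOpen U) ∧ ⋃₀ 𝒰 = Set.univ ∧
    ∃ D : ℝ, ∀ U ∈ 𝒰, ∀ x ∈ U, ∀ y ∈ U, dist x y ≤ D

/-- `asdim X ≤ n`: every uniformly bounded open cover `𝒱` refines a uniformly bounded open
cover `𝒰` of multiplicity at most `n + 1`. -/
def AsdimLE (X : Type*) [PseudoMetricSpace X] (n : ℕ) : Prop :=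
  ∀ 𝒱 : Set (Set X), IsUniformlyBoundedOpenCover 𝒱 →
    ∃ 𝒰 : Set (Set X), IsUniformlyBoundedOpenCover 𝒰 ∧
      (∀ x : X, {U ∈ 𝒰 | x ∈ U}.encard ≤ (n : ℕ∞) + 1) ∧
      ∀ V ∈ 𝒱, ∃ U ∈ 𝒰, V ⊆ U

/-- The asymptotic dimension: the least `n` with `asdim X ≤ n`, and `⊤` if there is none. -/
def asdim (X : Type*) [PseudoMetricSpace X] : ℕ∞ :=
  ⨅ (n : ℕ) (_ : AsdimLE X n), (n : ℕ∞)

/-! ### Word metrics -/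

section WordMetric

variable {G : Type*} [Group G]

/-- The least length of a word in the letters `S` that represents `g`. -/
def wordNorm (S : Set G) (g : G) : ℕ :=
  sInf {n | ∃ l : List G, (∀ s ∈ l, s ∈ S) ∧ l.prod = g ∧ l.length = n}

theorem exists_word {S : Set G} (hgen : Subgroup.closure S = ⊤) (hinv : ∀ s ∈ S, s⁻¹ ∈ S)
    (g : G) : ∃ l : List G, (∀ s ∈ l, s ∈ S) ∧ l.prod = g ∧ l.length = wordNorm S g := by
  have hg : g ∈ (Subgroup.closure S).toSubmonoid := by
    rw [hgen]
    exact Submonoid.mem_top g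
  rw [Subgroup.closure_toSubmonoid] at hg
  obtain ⟨l, hl, hp⟩ := Submonoid.exists_list_of_mem_closure hg
  refine Nat.sInf_mem (s := {n | ∃ l : List G, (∀ s ∈ l, s ∈ S) ∧ l.prod = g ∧ l.length = n})
    ⟨l.length, l, fun s hs => ?_, hp, rfl⟩
  rcases hl s hs with h | h
  · exact h
  · simpa using hinv _ (Set.mem_inv.1 h)

theorem wordNorm_le {S : Set G} (l : List G) (hl : ∀ s ∈ l, s ∈ S) :
    wordNorm S l.prod ≤ l.length :=
  Nat.sInf_le ⟨l, hl, rfl, rfl⟩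

theorem wordNorm_inv_le {S : Set G} (hgen : Subgroup.closure S = ⊤)
    (hinv : ∀ s ∈ S, s⁻¹ ∈ S) (g : G) : wordNorm S g⁻¹ ≤ wordNorm S g := by
  obtain ⟨l, hl, hp, hn⟩ := exists_word hgen hinv g
  have := wordNorm_le (S := S) (l.map (·⁻¹)).reverse (by
    intro s hs
    simp only [List.mem_reverse, List.mem_map] at hs
    obtain ⟨t, ht, rfl⟩ := hs
    exact hinv t (hl t ht))
  rw [← List.prod_inv_reverse, hp] at this
  simpa [hn] using this

/-- The left-invariant word metric `d(g, h) = ‖g⁻¹ h‖` of a symmetric generating set. -/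
@[reducible] def wordMetric (S : Set G) (hgen : Subgroup.closure S = ⊤)
    (hinv : ∀ s ∈ S, s⁻¹ ∈ S) : MetricSpace G where
  dist g h := (wordNorm S (g⁻¹ * h) : ℝ)
  dist_self g := by
    have := wordNorm_le (S := S) [] (by simp)
    simp at this
    simp [this]
  dist_comm g h := by
    have h1 := wordNorm_inv_le hgen hinv (g⁻¹ * h)
    have h2 := wordNorm_inv_le hgen hinv (h⁻¹ * g)
    simp only [mul_inv_rev, inv_inv] at h1 h2
    exact_mod_cast le_antisymm h2 h1
  dist_triangle x y z := by
    obtain ⟨l, hl, hp, hn⟩ := exists_word hgen hinv (x⁻¹ * y)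
    obtain ⟨l', hl', hp', hn'⟩ := exists_word hgen hinv (y⁻¹ * z)
    have := wordNorm_le (S := S) (l ++ l') (by
      intro s hs
      rcases List.mem_append.1 hs with h | h
      exacts [hl s h, hl' s h])
    rw [List.prod_append, hp, hp', List.length_append, hn, hn'] at this
    have e : x⁻¹ * y * (y⁻¹ * z) = x⁻¹ * z := by group
    rw [e] at this
    exact_mod_cast this
  eq_of_dist_eq_zero {g h} h0 := by
    obtain ⟨l, hl, hp, hn⟩ := exists_word hgen hinv (g⁻¹ * h)
    have h1 : wordNorm S (g⁻¹ * h) = 0 := by exact_mod_cast h0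
    rw [h1, List.length_eq_zero_iff] at hn
    rw [hn, List.prod_nil] at hp
    exact (inv_mul_eq_one.1 hp.symm)

/-- The asymptotic dimension of a group with the word metric of a symmetric generating set. -/
def asdimWord (S : Set G) (hgen : Subgroup.closure S = ⊤) (hinv : ∀ s ∈ S, s⁻¹ ∈ S) : ℕ∞ :=
  @asdim G (wordMetric S hgen hinv).toPseudoMetricSpace

end WordMetric

/-! ### Polycyclic groups and their Hirsch length -/

/-- A finite subnormal series `1 = Γ₀ ⊴ Γ₁ ⊴ ⋯ ⊴ Γₙ = G` with cyclic quotients `Γᵢ₊₁ / Γᵢ`.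
(The indices above `length` are dummies: there the series is constantly `G`.) -/
structure PolycyclicSeries (G : Type*) [Group G] where
  length : ℕ
  term : ℕ → Subgroup G
  term_zero : term 0 = ⊥
  term_length : term length = ⊤
  mono : Monotone term
  normal : ∀ i, ((term i).subgroupOf (term (i + 1))).Normal
  cyclic : ∀ i, IsCyclic (↥(term (i + 1)) ⧸ (term i).subgroupOf (term (i + 1)))

/-- A group is polycyclic if it has a polycyclic series. -/
def IsPolycyclic (G : Type*) [Group G] : Prop := Nonempty (PolycyclicSeries G)

open Classical in
/-- The sum of the ranks of the cyclic quotients of the series: an infinite cyclic group has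
rank `1`, a finite one has rank `0`. -/
def PolycyclicSeries.rankSum {G : Type*} [Group G] (s : PolycyclicSeries G) : ℕ :=
  ∑ i ∈ Finset.range s.length,
    if Infinite (↥(s.term (i + 1)) ⧸ (s.term i).subgroupOf (s.term (i + 1))) then 1 else 0

/-- The Hirsch length of a polycyclic group: the sum of the ranks of the quotients of a
polycyclic series (all such series give the same number; `⊤` if the group is not polycyclic). -/
def hirschLength (G : Type*) [Group G] : ℕ∞ :=
  ⨅ s : PolycyclicSeries G, (s.rankSum : ℕ∞)

/-! ### The Hirsch length of a connected nilpotent Lie group -/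

/-- The number of factors `ℝ` of a connected abelian Lie group `A`, written intrinsically as the
largest `n` such that `A` maps onto `ℝⁿ` by a continuous homomorphism. By `realRank_eq` below it
is `a` for `A ≅ ℝᵃ × 𝕋ᵇ`, and every connected abelian Lie group is of that form. -/
def realRank (A : Type*) [Group A] [TopologicalSpace A] : ℕ∞ :=
  ⨆ (n : ℕ) (_ : ∃ f : A →* Multiplicative (Fin n → ℝ), Continuous f ∧ Function.Surjective f),
    (n : ℕ∞)

theorem realRank_eq {A : Type*} [Group A] [TopologicalSpace A] (a b : ℕ)
    (e : A ≃ₜ* Multiplicative (Fin a → ℝ) × (Fin b → Circle)) : realRank A = a := by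
  refine le_antisymm (iSup₂_le ?_) ?_
  · rintro n ⟨f, hf, hs⟩
    let g : Multiplicative (Fin a → ℝ) × (Fin b → Circle) →* Multiplicative (Fin n → ℝ) :=
      f.comp e.symm.toMulEquiv.toMonoidHom
    have hg : Continuous g := hf.comp e.symm.continuous
    have hgs : Function.Surjective g := hs.comp e.symm.surjective
    have htorus : ∀ t : Fin b → Circle, g (1, t) = 1 := by
      intro t
      have hc : IsCompact (Set.range fun t : Fin b → Circle => Multiplicative.toAdd (g (1, t))) :=
        isCompact_range (continuous_toAdd.comp (hg.comp (by fun_prop)))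
      obtain ⟨C, hC⟩ := hc.isBounded.exists_norm_le
      by_contra hne
      have hpos : 0 < ‖Multiplicative.toAdd (g (1, t))‖ := by
        rw [norm_pos_iff]
        exact fun h => hne h
      obtain ⟨k, hk⟩ := Archimedean.arch (C + 1) hpos
      have h1 := hC _ ⟨t ^ k, rfl⟩
      have h2 : Multiplicative.toAdd (g (1, t ^ k)) = k • Multiplicative.toAdd (g (1, t)) := by
        rw [← toAdd_pow, ← map_pow]
        simp
      simp only at h1
      rw [h2, ← Nat.cast_smul_eq_nsmul ℝ, norm_smul] at h1
      simp only [nsmul_eq_mul, Real.norm_natCast] at h1 hk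
      linarith
    let φ : (Fin a → ℝ) →+ (Fin n → ℝ) :=
      { toFun := fun v => Multiplicative.toAdd (g (Multiplicative.ofAdd v, 1))
        map_zero' := by
          rw [ofAdd_zero]
          exact congrArg Multiplicative.toAdd (map_one g)
        map_add' := fun v w => by
          have h6 : ((Multiplicative.ofAdd (v + w), 1) :
              Multiplicative (Fin a → ℝ) × (Fin b → Circle)) =
              (Multiplicative.ofAdd v, 1) * (Multiplicative.ofAdd w, 1) := by
            rw [Prod.mk_mul_mk, mul_one, ofAdd_add]
          rw [h6, map_mul, toAdd_mul] }
    have hφ : Continuous φ :=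
      continuous_toAdd.comp (hg.comp (continuous_ofAdd.prodMk continuous_const))
    have hφs : Function.Surjective φ := by
      intro w
      obtain ⟨⟨v, t⟩, hvt⟩ := hgs (Multiplicative.ofAdd w)
      refine ⟨Multiplicative.toAdd v, ?_⟩
      have h3 : g (v, t) = g (v, 1) := by
        have h4 : ((v, t) : Multiplicative (Fin a → ℝ) × (Fin b → Circle)) = (v, 1) * (1, t) := by
          simp
        rw [h4, map_mul, htorus, mul_one]
      change Multiplicative.toAdd (g (v, 1)) = w
      rw [← h3, hvt, toAdd_ofAdd]
    have h5 := LinearMap.finrank_le_finrank_of_surjective (f := (φ.toRealLinearMap hφ).toLinearMap) hφs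
    simp only [Module.finrank_fin_fun] at h5
    exact_mod_cast h5
  · refine le_iSup₂_of_le a ⟨(MonoidHom.fst _ _).comp e.toMulEquiv.toMonoidHom, ?_, ?_⟩ le_rfl
    · exact continuous_fst.comp e.continuous
    · exact Prod.fst_surjective.comp e.surjective

/-- A finite central series `1 = Γ₀ ≤ Γ₁ ≤ ⋯ ≤ Γₙ = N` of closed connected normal subgroups of a
topological group, central meaning that `Γᵢ₊₁ / Γᵢ` lies in the centre of `N / Γᵢ`.
(The indices above `length` are dummies: there the series is constantly `N`.) -/
structure ConnectedCentralSeries (N : Type*) [Group N] [TopologicalSpace N] where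
  length : ℕ
  term : ℕ → Subgroup N
  term_zero : term 0 = ⊥
  term_length : term length = ⊤
  mono : Monotone term
  normal : ∀ i, (term i).Normal
  central : ∀ i, ⁅term (i + 1), (⊤ : Subgroup N)⁆ ≤ term i
  isClosed : ∀ i, IsClosed (term i : Set N)
  isConnected : ∀ i, IsConnected (term i : Set N)

/-- The total number of factors `ℝ` in the quotients `Γᵢ₊₁ / Γᵢ` of the series. -/
def ConnectedCentralSeries.realLength {N : Type*} [Group N] [TopologicalSpace N]
    (s : ConnectedCentralSeries N) : ℕ∞ :=
  ∑ i ∈ Finset.range s.length,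
    haveI := s.normal i
    realRank (↥(s.term (i + 1)) ⧸ (s.term i).subgroupOf (s.term (i + 1)))

/-- The Hirsch length of a connected nilpotent Lie group: the total number of factors `ℝ` in the
quotients of a central series of closed connected subgroups (all such series give the same
number). -/
def lieHirschLength (N : Type*) [Group N] [TopologicalSpace N] : ℕ∞ :=
  ⨅ s : ConnectedCentralSeries N, s.realLength

end

universe u

/-! ### Coloured partitions -/

section Coarse

variable {X : Type u} [PseudoMetricSpace X]

/-- `A` has a partition into pieces of diameter at most `D`, coloured with `n + 1` colours, in
which different pieces of the same colour are at distance greater than `r`. -/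
def ColoredPartition (A : Set X) (n : ℕ) (r D : ℝ) : Prop :=
  ∃ (ι : Type u) (c : X → ι) (col : X → ℕ), (∀ x ∈ A, col x ≤ n) ∧
    (∀ x ∈ A, ∀ y ∈ A, c x = c y → dist x y ≤ D) ∧
    ∀ x ∈ A, ∀ y ∈ A, dist x y ≤ r → col x = col y → c x = c y

/-- `A` has a partition into pieces of diameter at most `D` of which every ball of radius `r`
meets at most `n + 1`. -/
def SparsePartition (A : Set X) (n : ℕ) (r D : ℝ) : Prop :=
  ∃ (ι : Type u) (c : X → ι), (∀ x ∈ A, ∀ y ∈ A, c x = c y → dist x y ≤ D) ∧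
    ∀ x ∈ A, (c '' {y | y ∈ A ∧ dist x y ≤ r}).encard ≤ (n : ℕ∞) + 1

/-- The asymptotic dimension of the subset `A` is at most `n`. -/
def CoarseDimLE (A : Set X) (n : ℕ) : Prop := ∀ r : ℝ, ∃ D : ℝ, ColoredPartition A n r D

theorem ColoredPartition.mono {A : Set X} {n : ℕ} {r r' D D' : ℝ}
    (h : ColoredPartition A n r D) (hr : r' ≤ r) (hD : D ≤ D') : ColoredPartition A n r' D' := by
  obtain ⟨ι, c, col, h1, h2, h3⟩ := h
  exact ⟨ι, c, col, h1, fun x hx y hy e => (h2 x hx y hy e).trans hD,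
    fun x hx y hy e => h3 x hx y hy (e.trans hr)⟩

theorem ColoredPartition.exists_setLabels {A : Set X} {n : ℕ} {r D : ℝ}
    (h : ColoredPartition A n r D) : ∃ (c : X → Set X) (col : X → ℕ), (∀ x ∈ A, col x ≤ n) ∧
    (∀ x ∈ A, ∀ y ∈ A, c x = c y → dist x y ≤ D) ∧
    ∀ x ∈ A, ∀ y ∈ A, dist x y ≤ r → col x = col y → c x = c y := by
  obtain ⟨ι, c, col, h1, h2, h3⟩ := h
  refine ⟨fun x => {y | c y = c x}, col, h1, fun x hx y hy e => h2 x hx y hy ?_,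
    fun x hx y hy e e' => ?_⟩
  · have h4 : x ∈ {z | c z = c x} := rfl
    exact (Set.ext_iff.1 e x).1 h4
  · simp only [h3 x hx y hy e e']

/-- If a key with values in `{0, …, n}` determines the label on `B`, then there are at most
`n + 1` labels on `B`. -/
theorem encard_image_le_of_key {α : Type*} {β : Type*} {B : Set α} {ℓ : α → β} (key : α → ℕ)
    {n : ℕ} (hk : ∀ y ∈ B, key y ≤ n) (h : ∀ y ∈ B, ∀ z ∈ B, key y = key z → ℓ y = ℓ z) :
    (ℓ '' B).encard ≤ (n : ℕ∞) + 1 := by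
  classical
  rcases B.eq_empty_or_nonempty with rfl | ⟨b, hb⟩
  · simp
  let g : ℕ → β := fun i => if h : ∃ y ∈ B, key y = i then ℓ h.choose else ℓ b
  have hg : ∀ y ∈ B, ℓ y = g (key y) := by
    intro y hy
    have hex : ∃ z ∈ B, key z = key y := ⟨y, hy, rfl⟩
    simp only [g, dif_pos hex]
    exact h y hy _ hex.choose_spec.1 hex.choose_spec.2.symm
  have hsub : ℓ '' B ⊆ g '' (Finset.range (n + 1) : Set ℕ) := by
    rintro _ ⟨y, hy, rfl⟩
    refine ⟨key y, ?_, (hg y hy).symm⟩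
    simpa [Nat.lt_succ_iff] using hk y hy
  calc (ℓ '' B).encard ≤ (g '' (Finset.range (n + 1) : Set ℕ)).encard := Set.encard_le_encard hsub
    _ ≤ (Finset.range (n + 1) : Set ℕ).encard := Set.encard_image_le _ _
    _ = (n : ℕ∞) + 1 := by rw [Set.encard_coe_eq_coe_finsetCard]; simp

theorem SparsePartition.colored {A : Set X} {n : ℕ} {r D : ℝ} (hr : 0 ≤ r)
    (h : SparsePartition A n ((n + 1) * r) D) :
    ColoredPartition A n r (D + 2 * ((n + 1) * r)) := by
  obtain ⟨ι, c, hD, hc⟩ := h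
  let N : ℕ → X → Set ι := fun j x => c '' {y | y ∈ A ∧ dist x y ≤ j * r}
  have hNmono : ∀ x, ∀ i j, i ≤ j → N i x ⊆ N j x := by
    rintro x i j hij _ ⟨y, ⟨hy, hd⟩, rfl⟩
    exact ⟨y, ⟨hy, hd.trans (by gcongr)⟩, rfl⟩
  have hNtop : ∀ x ∈ A, (N (n + 1) x).encard ≤ (n : ℕ∞) + 1 := by
    intro x hx
    have := hc x hx
    simpa [N] using this
  have hNfin : ∀ x ∈ A, ∀ j ≤ n + 1, (N j x).Finite := by
    intro x hx j hj
    have h1 : (N (n + 1) x).Finite := by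
      apply Set.finite_of_encard_le_coe (k := n + 1)
      exact_mod_cast hNtop x hx
    exact h1.subset (hNmono x _ _ hj)
  have hNcard : ∀ x ∈ A, (N (n + 1) x).ncard ≤ n + 1 := by
    intro x hx
    have := hNtop x hx
    rw [← (hNfin x hx (n + 1) le_rfl).cast_ncard_eq] at this
    exact_mod_cast this
  have hself : ∀ x ∈ A, ∀ j, c x ∈ N j x := by
    intro x hx j
    exact ⟨x, ⟨hx, by rw [dist_self]; positivity⟩, rfl⟩
  have hex : ∀ x ∈ A, ∃ j, j ≤ n ∧ N j x = N (j + 1) x := by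
    intro x hx
    by_contra hcon
    push Not at hcon
    have hgrow : ∀ j, j ≤ n + 1 → j + 1 ≤ (N j x).ncard := by
      intro j
      induction j with
      | zero =>
        intro _
        have := (Set.ncard_pos (hNfin x hx 0 (by omega))).2 ⟨_, hself x hx 0⟩
        omega
      | succ j ih =>
        intro hj
        have h1 := ih (by omega)
        have h2 : N j x ⊂ N (j + 1) x :=
          (hNmono x j (j + 1) (by omega)).ssubset_of_ne (hcon j (by omega))
        have := Set.ncard_lt_ncard h2 (hNfin x hx _ hj)
        omega
    have h1 := hgrow (n + 1) le_rfl
    have h2 := hNcard x hx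
    omega
  choose! J hJ hJN using hex
  refine ⟨Set ι, fun x => N (J x) x, fun x => (N (J x) x).ncard - 1, ?_, ?_, ?_⟩
  · intro x hx
    have h1 := hNcard x hx
    have h2 := Set.ncard_le_ncard (hNmono x (J x) (n + 1) (by have := hJ x hx; omega))
      (hNfin x hx _ le_rfl)
    simp only
    omega
  · intro x hx y hy e
    have h1 : c x ∈ N (J y) y := by
      have := hself x hx (J x)
      rwa [show N (J x) x = N (J y) y from e] at this
    obtain ⟨z, ⟨hz, hd⟩, hcz⟩ := hNmono y (J y) (n + 1) (by have := hJ y hy; omega) h1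
    have h2 := hD x hx z hz hcz.symm
    push_cast at hd
    rw [dist_comm] at hd
    have h3 := dist_triangle x z y
    nlinarith [mul_nonneg (by positivity : (0 : ℝ) ≤ n + 1) hr]
  · have key : ∀ x ∈ A, ∀ y ∈ A, dist x y ≤ r → J x ≤ J y →
        (N (J x) x).ncard = (N (J y) y).ncard → N (J x) x = N (J y) y := by
      intro x hx y hy hd hle hcard
      refine Set.eq_of_subset_of_ncard_le ?_ hcard.ge (hNfin y hy _ (by have := hJ y hy; omega))
      rw [hJN y hy]
      refine subset_trans ?_ (hNmono y (J x + 1) (J y + 1) (by omega))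
      rintro _ ⟨z, ⟨hz, hdz⟩, rfl⟩
      refine ⟨z, ⟨hz, ?_⟩, rfl⟩
      have := dist_triangle y x z
      rw [dist_comm y x] at this
      push_cast
      linarith
    intro x hx y hy hd hcol
    have hpos : ∀ x ∈ A, 0 < (N (J x) x).ncard := fun x hx =>
      (Set.ncard_pos (hNfin x hx _ (by have := hJ x hx; omega))).2 ⟨_, hself x hx _⟩
    have h1 := hpos x hx
    have h2 := hpos y hy
    have h3 : (N (J x) x).ncard = (N (J y) y).ncard := by simp only at hcol; omega
    rcases le_total (J x) (J y) with hle | hle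
    · exact key x hx y hy hd hle h3
    · exact (key y hy x hx (by rwa [dist_comm]) hle h3.symm).symm

theorem coarseDimLE_of_sparse {A : Set X} {n : ℕ}
    (h : ∀ r : ℝ, 0 ≤ r → ∃ D, SparsePartition A n r D) : CoarseDimLE A n := by
  intro r
  obtain ⟨D, hD⟩ := h ((n + 1) * max r 0) (by positivity)
  exact ⟨_, (hD.colored (le_max_right _ _)).mono (le_max_left _ _) le_rfl⟩

theorem ediv_emod_of_close {a b P : ℤ} (hP : 0 < P) (h1 : a ≤ b) (h2 : b - a < P) :
    (b / P = a / P ∧ b % P = a % P + (b - a)) ∨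
      (b / P = a / P + 1 ∧ b % P + P = a % P + (b - a)) := by
  have ha := Int.mul_ediv_add_emod a P
  have hb := Int.mul_ediv_add_emod b P
  have ha0 := Int.emod_nonneg a hP.ne'
  have hb0 := Int.emod_nonneg b hP.ne'
  have ha1 := Int.emod_lt_of_pos a hP
  have hb1 := Int.emod_lt_of_pos b hP
  have h3 : a / P ≤ b / P := Int.ediv_le_ediv hP h1
  have h4 : b / P ≤ a / P + 1 := by
    by_contra hcon
    push Not at hcon
    have : P * (a / P + 2) ≤ P * (b / P) := by gcongr; omega
    linarith [mul_add P (a / P) 2]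
  rcases (by omega : b / P = a / P ∨ b / P = a / P + 1) with h | h
  · left
    refine ⟨h, ?_⟩
    rw [h] at hb
    linarith
  · right
    refine ⟨h, ?_⟩
    rw [h] at hb
    linarith [mul_add P (a / P) 1]

end Coarse

theorem exists_representative {X β : Type*} (C : X → β) (A : Set X) : ∃ rep : X → X,
    (∀ x ∈ A, rep x ∈ A) ∧ (∀ x ∈ A, C (rep x) = C x) ∧
      ∀ x ∈ A, ∀ y ∈ A, C x = C y → rep x = rep y := by
  refine ⟨fun x => @Function.invFunOn _ _ ⟨x⟩ C A (C x), fun x hx => ?_, fun x hx => ?_,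
    fun x _ y _ e => ?_⟩
  · have : Nonempty X := ⟨x⟩
    exact Function.invFunOn_mem ⟨x, hx, rfl⟩
  · have : Nonempty X := ⟨x⟩
    exact Function.invFunOn_eq ⟨x, hx, rfl⟩
  · simp only [e]

section Coarse

variable {X : Type u} [PseudoMetricSpace X]

/-- A one-dimensional Hurewicz theorem at a fixed scale: fibring over `ℤ` raises the dimension by
at most one. -/
theorem sparsePartition_of_fibration {A : Set X} {n : ℕ} (f : X → ℤ) {r : ℝ} {s : ℕ}
    (hs : ∀ x ∈ A, ∀ y ∈ A, dist x y ≤ 2 * r → |f x - f y| ≤ s)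
    (hfib : ∀ (m : ℕ) (ρ : ℝ), ∃ D : ℝ, ∀ a : ℤ,
      ColoredPartition (A ∩ {x | a ≤ f x ∧ f x ≤ a + m}) n ρ D) :
    ∃ D, SparsePartition A (n + 1) r D := by
  classical
  let T : ℕ := (n + 1) * (s + 1)
  obtain ⟨M, hM⟩ : ∃ M : ℕ, M = T + s + 1 := ⟨_, rfl⟩
  obtain ⟨D, hcol⟩ := hfib (2 * M) (2 * r)
  obtain ⟨D', hcol'⟩ := hfib (2 * M) (2 * (r + D))
  choose c col hc1 hc2 hc3 using fun k : ℤ => (hcol (2 * M * k)).exists_setLabels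
  choose c' col' hc1' hc2' hc3' using fun j : ℤ => (hcol' (2 * M * j - M)).exists_setLabels
  let q : X → ℤ := fun x => f x / (2 * M)
  let p : X → ℤ := fun x => f x % (2 * M)
  have hMpos : (0 : ℤ) < 2 * M := by omega
  have hqp : ∀ x, f x = 2 * M * q x + p x := fun x => (Int.mul_ediv_add_emod _ _).symm
  have hp0 : ∀ x, 0 ≤ p x := fun x => Int.emod_nonneg _ hMpos.ne'
  have hp1 : ∀ x, p x < 2 * M := fun x => Int.emod_lt_of_pos _ hMpos
  have hclose : ∀ x y, f x ≤ f y → f y - f x < 2 * M →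
      (q y = q x ∧ p y = p x + (f y - f x)) ∨ (q y = q x + 1 ∧ p y + 2 * M = p x + (f y - f x)) :=
    fun x y h1 h2 => ediv_emod_of_close hMpos h1 h2
  let w : X → ℤ := fun x => if p x < M then q x else q x + 1
  let h : X → ℤ := fun x => if p x < M then p x else 2 * M - p x
  have hmem : ∀ x ∈ A, x ∈ A ∩ {x' | 2 * M * q x ≤ f x' ∧ f x' ≤ 2 * M * q x + (2 * M : ℕ)} := by
    intro x hx
    have h1 := hqp x
    have h2 := hp0 x
    have h3 := hp1 x
    refine ⟨hx, ?_, ?_⟩ <;> push_cast <;> linarith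
  have hmem' : ∀ x ∈ A, x ∈ A ∩ {x' | 2 * M * w x - M ≤ f x' ∧
      f x' ≤ 2 * M * w x - M + (2 * M : ℕ)} := by
    intro x hx
    have h1 := hqp x
    have h2 := hp0 x
    have h3 := hp1 x
    refine ⟨hx, ?_⟩
    simp only [Set.mem_ofPred_eq, w]
    push_cast
    split_ifs with h4
    · constructor <;> linarith
    · rw [mul_add]
      constructor <;> linarith
  let C : X → ℤ × ℤ × Set X := fun x => (q x, w x, c (q x) x)
  obtain ⟨rep, hrepA, hrepC, hrep⟩ := exists_representative C A
  have hrepq : ∀ x ∈ A, q (rep x) = q x := fun x hx => congrArg Prod.fst (hrepC x hx)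
  have hrepw : ∀ x ∈ A, w (rep x) = w x := fun x hx => congrArg (fun t => t.2.1) (hrepC x hx)
  have hrepD : ∀ x ∈ A, dist x (rep x) ≤ D := by
    intro x hx
    have h1 : c (q (rep x)) (rep x) = c (q x) x := congrArg (fun t => t.2.2) (hrepC x hx)
    have h2 := hmem _ (hrepA x hx)
    rw [hrepq x hx] at h1 h2
    exact hc2 (q x) x (hmem x hx) _ h2 h1.symm
  have hmemrep : ∀ x ∈ A, rep x ∈ A ∩ {x' | 2 * M * w x - M ≤ f x' ∧
      f x' ≤ 2 * M * w x - M + (2 * M : ℕ)} := by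
    intro x hx
    have h2 := hmem' _ (hrepA x hx)
    rwa [hrepw x hx] at h2
  let τ : X → ℕ := fun x => (col (q x) x + 1) * (s + 1)
  have hτT : ∀ x ∈ A, τ x ≤ T := fun x hx =>
    Nat.mul_le_mul_right _ (Nat.succ_le_succ (hc1 (q x) x (hmem x hx)))
  have hτs : ∀ x, s < τ x := by
    intro x
    have : 1 * (s + 1) ≤ τ x := Nat.mul_le_mul_right _ (by omega)
    omega
  let ℓ : X → (ℤ × Set X) ⊕ (ℤ × Set X) := fun x =>
    if h x ≤ τ x then Sum.inr (w x, c' (w x) (rep x)) else Sum.inl (q x, c (q x) x)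
  refine ⟨max D (D' + 2 * D), _, ℓ, ?_, ?_⟩
  · intro x hx y hy hxy
    by_cases h1 : h x ≤ τ x <;> by_cases h2 : h y ≤ τ y
    · simp only [ℓ, if_pos h1, if_pos h2, Sum.inr.injEq, Prod.mk.injEq] at hxy
      obtain ⟨hw, he⟩ := hxy
      have h4 := hmemrep y hy
      rw [← hw] at h4 he
      have h5 := hc2' (w x) _ (hmemrep x hx) _ h4 he
      have h6 := hrepD x hx
      have h7 := hrepD y hy
      rw [dist_comm] at h7
      have h8 := dist_triangle4 x (rep x) (rep y) y
      exact le_max_of_le_right (by linarith)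
    · simp only [ℓ, if_pos h1, if_neg h2, reduceCtorEq] at hxy
    · simp only [ℓ, if_neg h1, if_pos h2, reduceCtorEq] at hxy
    · simp only [ℓ, if_neg h1, if_neg h2, Sum.inl.injEq, Prod.mk.injEq] at hxy
      obtain ⟨hq, he⟩ := hxy
      have h4 := hmem y hy
      rw [← hq] at h4 he
      exact le_max_of_le_left (hc2 (q x) x (hmem x hx) y h4 he)
  · intro x hx
    set B : Set X := {y | y ∈ A ∧ dist x y ≤ r} with hB
    have hBA : ∀ y ∈ B, y ∈ A := fun y hy => hy.1
    have hBd : ∀ y ∈ B, ∀ z ∈ B, dist y z ≤ 2 * r := by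
      intro y hy z hz
      have h1 := dist_triangle y x z
      have h2 := hy.2
      have h3 := hz.2
      rw [dist_comm] at h2
      linarith
    have hBf : ∀ y ∈ B, ∀ z ∈ B, |f y - f z| ≤ s := fun y hy z hz =>
      hs y (hBA y hy) z (hBA z hz) (hBd y hy z hz)
    by_cases hslab : ∀ y ∈ B, ∀ z ∈ B, q y = q z
    · have hp : ∀ y ∈ B, ∀ z ∈ B, |p y - p z| ≤ s := by
        intro y hy z hz
        have h1 := hBf y hy z hz
        rw [hqp y, hqp z, hslab y hy z hz] at h1
        simpa using h1
      have hc : ∀ y ∈ B, ∀ z ∈ B, col (q y) y = col (q z) z → c (q y) y = c (q z) z := by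
        intro y hy z hz he
        have h1 := hmem z (hBA z hz)
        rw [← hslab y hy z hz] at he h1 ⊢
        exact hc3 (q y) y (hmem y (hBA y hy)) z h1 (hBd y hy z hz) he
      have hlowhigh : ∀ y ∈ B, ∀ z ∈ B, h y ≤ τ y → ¬ h z ≤ τ z →
          col (q y) y + 1 = col (q z) z → False := by
        intro y hy z hz h1 h2 he
        have h3 := abs_le.1 (hp y hy z hz)
        have h4 : τ z = τ y + (s + 1) := by
          simp only [τ, ← he]
          ring
        simp only [h] at h1 h2
        split_ifs at h1 h2 <;> omega
      refine (encard_image_le_of_key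
        (fun y => if h y ≤ τ y then col (q y) y + 1 else col (q y) y) (n := n + 1) ?_ ?_)
      · intro y hy
        have h1 := hc1 (q y) y (hmem y (hBA y hy))
        split_ifs <;> omega
      · intro y hy z hz he
        by_cases h1 : h y ≤ τ y <;> by_cases h2 : h z ≤ τ z <;>
          simp only [h1, h2, if_true, if_false] at he
        · have hcc := hc y hy z hz (by omega)
          have hww : w y = w z := by
            have h3 := abs_le.1 (hp y hy z hz)
            have h4 := hτT y (hBA y hy)
            have h5 := hτT z (hBA z hz)
            have h6 := hslab y hy z hz
            simp only [h] at h1 h2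
            simp only [w]
            split_ifs at h1 h2 ⊢ <;> omega
          have hC : C y = C z := by
            simp only [C, Prod.mk.injEq]
            exact ⟨hslab y hy z hz, hww, hcc⟩
          simp only [ℓ, if_pos h1, if_pos h2, hww, hrep y (hBA y hy) z (hBA z hz) hC]
        · exact (hlowhigh y hy z hz h1 h2 (by omega)).elim
        · exact (hlowhigh z hz y hy h2 h1 (by omega)).elim
        · simp only [ℓ, if_neg h1, if_neg h2, hc y hy z hz he]
          rw [hslab y hy z hz]
    · push Not at hslab
      obtain ⟨y₀, hy₀, z₀, hz₀, hlt⟩ : ∃ y₀ ∈ B, ∃ z₀ ∈ B, q z₀ = q y₀ + 1 := by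
        obtain ⟨y, hy, z, hz, hne⟩ := hslab
        have h1 := abs_le.1 (hBf y hy z hz)
        rcases le_total (f y) (f z) with hle | hle
        · rcases hclose y z hle (by omega) with h2 | h2
          · exact (hne h2.1.symm).elim
          · exact ⟨y, hy, z, hz, h2.1⟩
        · rcases hclose z y hle (by omega) with h2 | h2
          · exact (hne h2.1).elim
          · exact ⟨z, hz, y, hy, h2.1⟩
      have hwall : ∀ y ∈ B, h y ≤ s ∧ w y = q z₀ := by
        intro y hy
        have h1 := abs_le.1 (hBf y₀ hy₀ z₀ hz₀)
        have h2 := abs_le.1 (hBf y hy z₀ hz₀)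
        have h3 := abs_le.1 (hBf y hy y₀ hy₀)
        have h4 := hp0 y₀
        have h5 := hp1 y₀
        have h6 := hp0 z₀
        have h7 := hp1 z₀
        have h8 := hp0 y
        have h9 := hp1 y
        have h10 : f y₀ ≤ f z₀ := by
          by_contra hcon
          rcases hclose z₀ y₀ (by omega) (by omega) with h | h <;> omega
        have h11 := hclose y₀ z₀ h10 (by omega)
        have h12 : (f y ≤ f y₀ → _) := fun hle => hclose y y₀ hle (by omega)
        have h13 : (f y₀ ≤ f y → _) := fun hle => hclose y₀ y hle (by omega)
        have h14 : (f y ≤ f z₀ → _) := fun hle => hclose y z₀ hle (by omega)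
        have h15 : (f z₀ ≤ f y → _) := fun hle => hclose z₀ y hle (by omega)
        simp only [h, w]
        split_ifs <;> omega
      have hlow : ∀ y ∈ B, ℓ y = Sum.inr (q z₀, c' (q z₀) (rep y)) := by
        intro y hy
        obtain ⟨h1, h2⟩ := hwall y hy
        have h3 := hτs y
        simp only [ℓ, if_pos (show h y ≤ τ y by omega), h2]
      have hmr : ∀ y ∈ B, rep y ∈ A ∩ {x' | 2 * M * q z₀ - M ≤ f x' ∧
          f x' ≤ 2 * M * q z₀ - M + (2 * M : ℕ)} := by
        intro y hy
        have h1 := hmemrep y (hBA y hy)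
        rwa [(hwall y hy).2] at h1
      refine (encard_image_le_of_key (fun y => col' (q z₀) (rep y)) (n := n) ?_ ?_).trans ?_
      · exact fun y hy => hc1' _ _ (hmr y hy)
      · intro y hy z hz he
        rw [hlow y hy, hlow z hz]
        have h1 := hrepD y (hBA y hy)
        have h2 := hrepD z (hBA z hz)
        have h3 := hBd y hy z hz
        rw [dist_comm] at h1
        have h4 := dist_triangle4 (rep y) y z (rep z)
        rw [hc3' (q z₀) _ (hmr y hy) _ (hmr z hz) (by linarith) he]
      · push_cast
        exact le_self_add

theorem coarseDimLE_of_fibration {A : Set X} {n : ℕ} (f : X → ℤ)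
    (hf : ∀ r : ℝ, ∃ s : ℕ, ∀ x ∈ A, ∀ y ∈ A, dist x y ≤ r → |f x - f y| ≤ s)
    (hfib : ∀ (m : ℕ) (ρ : ℝ), ∃ D : ℝ, ∀ a : ℤ,
      ColoredPartition (A ∩ {x | a ≤ f x ∧ f x ≤ a + m}) n ρ D) :
    CoarseDimLE A (n + 1) :=
  coarseDimLE_of_sparse fun r _ => by
    obtain ⟨s, hs⟩ := hf (2 * r)
    exact sparsePartition_of_fibration f hs hfib

/-- Partitions can be pulled back along maps that change distances by a bounded amount. -/
theorem ColoredPartition.pullback {Y : Type u} [PseudoMetricSpace Y] {A : Set X} {B : Set Y}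
    {n : ℕ} {r D ρ : ℝ} (ψ : X → Y)
    (hψ : ∀ x ∈ A, ψ x ∈ B) (hd : ∀ x ∈ A, ∀ y ∈ A, |dist (ψ x) (ψ y) - dist x y| ≤ ρ)
    (h : ColoredPartition B n (r + ρ) D) : ColoredPartition A n r (D + ρ) := by
  obtain ⟨ι, c, col, h1, h2, h3⟩ := h
  refine ⟨ι, c ∘ ψ, col ∘ ψ, fun x hx => h1 _ (hψ x hx), fun x hx y hy e => ?_,
    fun x hx y hy e => h3 _ (hψ x hx) _ (hψ y hy) ?_⟩
  · have := abs_le.1 (hd x hx y hy)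
    have := h2 _ (hψ x hx) _ (hψ y hy) e
    linarith
  · have := abs_le.1 (hd x hx y hy)
    linarith

/-- A set in the `C`-neighbourhood of `B` has at most the dimension of `B`. -/
theorem CoarseDimLE.of_near {A B : Set X} {n : ℕ} {C : ℝ} (h : CoarseDimLE B n)
    (hAB : ∀ x ∈ A, ∃ y ∈ B, dist x y ≤ C) : CoarseDimLE A n := by
  intro r
  choose! ψ hψ hd using hAB
  obtain ⟨D, hD⟩ := h (r + 2 * C)
  refine ⟨_, hD.pullback ψ hψ fun x hx y hy => abs_le.2 ⟨?_, ?_⟩⟩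
  · have h1 := dist_triangle4 x (ψ x) (ψ y) y
    have h2 := hd x hx
    have h3 := hd y hy
    rw [dist_comm] at h3
    linarith
  · have h1 := dist_triangle4 (ψ x) x y (ψ y)
    have h2 := hd x hx
    have h3 := hd y hy
    rw [dist_comm] at h2
    linarith

theorem CoarseDimLE.mono {A : Set X} {n m : ℕ} (h : CoarseDimLE A n) (hnm : n ≤ m) :
    CoarseDimLE A m := fun r => by
  obtain ⟨D, ι, c, col, h1, h2⟩ := h r
  exact ⟨D, ι, c, col, fun x hx => (h1 x hx).trans hnm, h2⟩

theorem coarseDimLE_singleton (x : X) : CoarseDimLE {x} 0 := fun _ =>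
  ⟨0, PUnit, fun _ => PUnit.unit, fun _ => 0, by simp, by simp, by simp⟩

/-- The definition through open covers follows from the one through coloured partitions. -/
theorem asdimLE_of_coarseDimLE [Nonempty X] {n : ℕ} (h : CoarseDimLE (Set.univ : Set X) n) : AsdimLE X n := by
  rintro 𝒱 ⟨-, hcov, d, hd⟩
  obtain ⟨r, hr, hdr⟩ : ∃ r : ℝ, 0 < r ∧ d < r := ⟨max d 0 + 1, by positivity, by
    have := le_max_left d 0
    linarith⟩
  obtain ⟨D, ι, c, col, h1, h2, h3⟩ := h (2 * r)
  let U : X → Set X := fun x => Metric.thickening r {y | c y = c x}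
  refine ⟨Set.range U, ⟨?_, ?_, D + 2 * r, ?_⟩, ?_, ?_⟩
  · rintro _ ⟨x, rfl⟩
    exact Metric.isOpen_thickening
  · refine Set.eq_univ_of_forall fun x => ⟨U x, ⟨x, rfl⟩, ?_⟩
    exact Metric.self_subset_thickening hr _ rfl
  · rintro _ ⟨x, rfl⟩ y hy z hz
    obtain ⟨y', hy', hyd⟩ := Metric.mem_thickening_iff.1 hy
    obtain ⟨z', hz', hzd⟩ := Metric.mem_thickening_iff.1 hz
    have h4 := h2 y' trivial z' trivial (hy'.trans hz'.symm)
    have h5 := dist_triangle4 y y' z' z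
    rw [dist_comm] at hzd
    linarith
  · intro x
    have hsub : {V | V ∈ Set.range U ∧ x ∈ V} ⊆ U '' {y | dist x y ≤ r} := by
      rintro _ ⟨⟨z, rfl⟩, hz⟩
      obtain ⟨z', hz', hzd⟩ := Metric.mem_thickening_iff.1 hz
      refine ⟨z', hzd.le, ?_⟩
      simp only [U]
      rw [show c z' = c z from hz']
    refine (Set.encard_le_encard hsub).trans
      (encard_image_le_of_key col (fun y _ => h1 y trivial) fun y hy z hz e => ?_)
    have h4 : dist y z ≤ 2 * r := by
      have h5 := dist_triangle y x z
      have h6 : dist x y ≤ r := hy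
      have h7 : dist x z ≤ r := hz
      rw [dist_comm] at h6
      linarith
    simp only [U]
    rw [h3 y trivial z trivial h4 e]
  · intro V hV
    rcases V.eq_empty_or_nonempty with rfl | ⟨x, hx⟩
    · exact ⟨_, ⟨Classical.arbitrary X, rfl⟩, Set.empty_subset _⟩
    · exact ⟨U x, ⟨x, rfl⟩, fun y hy => Metric.mem_thickening_iff.2 ⟨x, rfl,
        (hd V hV y hy x hx).trans_lt hdr⟩⟩

theorem asdim_le_of_coarseDimLE [Nonempty X] {n : ℕ} (h : CoarseDimLE (Set.univ : Set X) n) :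
    asdim X ≤ n :=
  iInf₂_le n (asdimLE_of_coarseDimLE h)

end Coarse

/-! ### Groups with a left-invariant metric -/

/-- A filtration `E` of `ℤ` by symmetric, totally bounded sets with `E R + E S ⊆ E (R + S)` either
consists of finite sets or is eventually everything. -/
theorem int_filtration_dichotomy (E : ℝ → Set ℤ) (hneg : ∀ R, ∀ e ∈ E R, -e ∈ E R)
    (hadd : ∀ R S, ∀ e ∈ E R, ∀ f ∈ E S, e + f ∈ E (R + S)) (hmono : Monotone E)
    (hex : ∀ e, ∃ R, e ∈ E R)
    (htb : ∀ R ε, 0 < ε → ∃ F : Finset ℤ, ∀ e ∈ E R, ∃ i ∈ F, e - i ∈ E ε) :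
    (∀ R, (E R).Finite) ∨ ∃ C, ∀ e, e ∈ E C := by
  by_cases hfin : ∀ R, (E R).Finite
  · exact Or.inl hfin
  right
  push Not at hfin
  obtain ⟨R, hR⟩ := hfin
  have hinf : ∀ ε, 0 < ε → (E ε).Infinite := by
    intro ε hε hf
    obtain ⟨F, hF⟩ := htb R ε hε
    refine hR (((F.finite_toSet).add hf).subset fun e he => ?_)
    obtain ⟨i, hi, h⟩ := hF e he
    exact ⟨i, hi, e - i, h, by ring⟩
  have hbig : ∀ ε, 0 < ε → ∀ N : ℤ, ∃ e ∈ E ε, N < e := by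
    intro ε hε N
    by_contra hcon
    push Not at hcon
    refine hinf ε hε ((Set.finite_Icc (-N) N).subset fun e he => ⟨?_, hcon e he⟩)
    have := hcon _ (hneg ε e he)
    omega
  obtain ⟨F, hF⟩ := htb 1 (1 / 2) (by norm_num)
  obtain ⟨N, hN⟩ : ∃ N : ℤ, ∀ i ∈ F, |i| ≤ N :=
    ⟨∑ i ∈ F, |i|, fun i hi => Finset.single_le_sum (f := fun i : ℤ => |i|)
      (fun _ _ => abs_nonneg _) hi⟩
  obtain ⟨w, hw, hNw⟩ := hbig (1 / 2) (by norm_num) N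
  have hdesc : ∀ e ∈ E 1, ∃ e' ∈ E 1, e' < e ∧ e ≤ e' + (N + w) := by
    intro e he
    obtain ⟨i, hi, h⟩ := hF e he
    have h1 := abs_le.1 (hN i hi)
    refine ⟨e - i + -w, ?_, by omega, by omega⟩
    have := hadd _ _ _ h _ (hneg _ _ hw)
    norm_num at this
    exact this
  have hnear : ∀ z : ℤ, ∀ k : ℕ, ∀ e ∈ E 1, z ≤ e → e ≤ z + k →
      ∃ e' ∈ E 1, z ≤ e' ∧ e' ≤ z + (N + w) := by
    intro z k
    induction k with
    | zero => exact fun e he h1 h2 => ⟨e, he, h1, by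
        obtain ⟨e', -, h3, h4⟩ := hdesc e he
        omega⟩
    | succ k ih =>
      intro e he h1 h2
      obtain ⟨e', he', h3, h4⟩ := hdesc e he
      by_cases h5 : z ≤ e'
      · exact ih e' he' h5 (by omega)
      · exact ⟨e, he, h1, by omega⟩
  choose ρ hρ using hex
  obtain ⟨C, hC⟩ := ((Finset.Icc (-(N + w)) 0).image ρ).exists_le
  refine ⟨1 + C, fun z => ?_⟩
  obtain ⟨e, he, hze⟩ := hbig 1 one_pos z
  obtain ⟨e', he', h1, h2⟩ := hnear z (e - z).toNat e he hze.le (by omega)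
  have h3 : z - e' ∈ E C := hmono (hC _ (Finset.mem_image_of_mem ρ
    (Finset.mem_Icc.2 ⟨by omega, by omega⟩))) (hρ _)
  have := hadd _ _ _ he' _ h3
  rwa [add_sub_cancel] at this

section Group

variable {G : Type u} [Group G] [PseudoMetricSpace G]

/-- The balls of the left-invariantly metrised group `G` are totally bounded. -/
def TotallyBoundedBalls (G : Type*) [Group G] [PseudoMetricSpace G] : Prop :=
  ∀ R ε : ℝ, 0 < ε → ∃ F : Finset G, ∀ x, dist 1 x ≤ R → ∃ y ∈ F, dist y x ≤ ε

/-- The exponents `e` for which `g ^ e` is at distance at most `R` from the subgroup `K`. -/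
def returnTimes (K : Subgroup G) (g : G) (R : ℝ) : Set ℤ := {e | ∃ k ∈ K, dist 1 (k * g ^ e) ≤ R}

theorem dist_one_mul_le (hinv : ∀ a x y : G, dist (a * x) (a * y) = dist x y) (x y : G) :
    dist 1 (x * y) ≤ dist 1 x + dist 1 y := by
  have h1 := dist_triangle 1 x (x * y)
  have h2 := hinv x 1 y
  rw [mul_one] at h2
  linarith

theorem dist_one_inv (hinv : ∀ a x y : G, dist (a * x) (a * y) = dist x y) (x : G) :
    dist 1 x⁻¹ = dist 1 x := by
  have h2 := hinv x 1 x⁻¹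
  rw [mul_one, mul_inv_cancel, dist_comm x 1] at h2
  exact h2.symm

theorem dist_eq_dist_one (hinv : ∀ a x y : G, dist (a * x) (a * y) = dist x y) (x y : G) :
    dist x y = dist 1 (x⁻¹ * y) := by
  rw [← hinv x⁻¹ x y, inv_mul_cancel]

theorem returnTimes_dichotomy (hinv : ∀ a x y : G, dist (a * x) (a * y) = dist x y)
    (hTB : TotallyBoundedBalls G) (K : Subgroup G) (g : G)
    (hg : ∀ e : ℤ, ∀ k ∈ K, g ^ e * k * (g ^ e)⁻¹ ∈ K) :
    (∀ R, (returnTimes K g R).Finite) ∨ ∃ C, ∀ e, e ∈ returnTimes K g C := by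
  classical
  refine int_filtration_dichotomy (returnTimes K g) ?_ ?_ ?_ ?_ ?_
  · rintro R e ⟨k, hk, h⟩
    refine ⟨g ^ (-e) * k⁻¹ * (g ^ (-e))⁻¹, hg _ _ (K.inv_mem hk), ?_⟩
    rw [inv_mul_cancel_right, zpow_neg, ← mul_inv_rev, dist_one_inv hinv]
    exact h
  · rintro R S e ⟨k, hk, h⟩ f ⟨l, hl, h'⟩
    refine ⟨k * (g ^ e * l * (g ^ e)⁻¹), K.mul_mem hk (hg _ _ hl), ?_⟩
    have e1 : k * (g ^ e * l * (g ^ e)⁻¹) * g ^ (e + f) = (k * g ^ e) * (l * g ^ f) := by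
      rw [zpow_add]
      group
    rw [e1]
    exact (dist_one_mul_le hinv _ _).trans (add_le_add h h')
  · rintro R S hRS e ⟨k, hk, h⟩
    exact ⟨k, hk, h.trans hRS⟩
  · exact fun e => ⟨_, 1, K.one_mem, le_rfl⟩
  · intro R ε hε
    obtain ⟨F, hF⟩ := hTB R (ε / 2) (by positivity)
    let φ : G → ℤ := fun y =>
      if h : ∃ e : ℤ, ∃ k ∈ K, dist y (k * g ^ e) ≤ ε / 2 then h.choose else 0
    refine ⟨F.image φ, ?_⟩
    rintro e ⟨k, hk, h⟩
    obtain ⟨y, hy, hyd⟩ := hF _ h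
    refine ⟨φ y, Finset.mem_image_of_mem _ hy, ?_⟩
    have hex : ∃ e : ℤ, ∃ k ∈ K, dist y (k * g ^ e) ≤ ε / 2 := ⟨e, k, hk, hyd⟩
    simp only [φ, dif_pos hex]
    obtain ⟨l, hl, hd⟩ := hex.choose_spec
    generalize hex.choose = i at hd
    refine ⟨g ^ (-i) * (l⁻¹ * k) * (g ^ (-i))⁻¹, hg _ _ (K.mul_mem (K.inv_mem hl) hk), ?_⟩
    have e1 : g ^ (-i) * (l⁻¹ * k) * (g ^ (-i))⁻¹ * g ^ (e - i) = (l * g ^ i)⁻¹ * (k * g ^ e) := by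
      group
    rw [e1, ← dist_eq_dist_one hinv]
    have := dist_triangle (l * g ^ i) y (k * g ^ e)
    rw [dist_comm _ y] at this
    linarith

theorem zpow_notMem_of_finite_returnTimes {K : Subgroup G} {g : G}
    (hfin : (returnTimes K g 0).Finite) {e : ℤ} (he : g ^ e ∈ K) : e = 0 := by
  by_contra hne
  have hinj : Function.Injective fun i : ℤ => e * i := mul_right_injective₀ hne
  refine Set.infinite_of_injective_forall_mem hinj (s := returnTimes K g 0) (fun i => ?_) hfin
  refine ⟨(g ^ (e * i))⁻¹, K.inv_mem ?_, by simp⟩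
  rw [zpow_mul]
  exact K.zpow_mem he i

/-- Extending a subgroup by an element with finite sets of return times raises the dimension by at
most one. -/
theorem CoarseDimLE.of_finite_returnTimes (hinv : ∀ a x y : G, dist (a * x) (a * y) = dist x y)
    {K : Subgroup G} {g : G} (hg : ∀ e : ℤ, ∀ k ∈ K, g ^ e * k * (g ^ e)⁻¹ ∈ K)
    (hfin : ∀ R, (returnTimes K g R).Finite) {n : ℕ} (hK : CoarseDimLE (K : Set G) n) {A : Set G}
    (hA : ∀ x ∈ A, ∃ k ∈ K, ∃ e : ℤ, x = k * g ^ e) : CoarseDimLE A (n + 1) := by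
  choose! κ hκ f hf using hA
  refine coarseDimLE_of_fibration f (fun r => ?_) fun m ρ => ?_
  · obtain ⟨N, hN⟩ := ((hfin r).image fun e => e.natAbs).bddAbove
    refine ⟨N, fun x hx y hy hd => ?_⟩
    have h1 : f x - f y ∈ returnTimes K g r := by
      refine ⟨g ^ (-f y) * ((κ y)⁻¹ * κ x) * (g ^ (-f y))⁻¹,
        hg _ _ (K.mul_mem (K.inv_mem (hκ y hy)) (hκ x hx)), ?_⟩
      have e1 : g ^ (-f y) * ((κ y)⁻¹ * κ x) * (g ^ (-f y))⁻¹ * g ^ (f x - f y) =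
          (κ y * g ^ f y)⁻¹ * (κ x * g ^ f x) := by
        group
      rw [e1, ← hf x hx, ← hf y hy, ← dist_eq_dist_one hinv, dist_comm]
      exact hd
    have h2 : (f x - f y).natAbs ≤ N := hN ⟨_, h1, rfl⟩
    rw [Int.abs_eq_natAbs]
    exact_mod_cast h2
  · obtain ⟨B, hB⟩ := ((Finset.Icc (0 : ℤ) m).image fun e => dist 1 (g ^ e)).exists_le
    have hB' : ∀ e : ℤ, 0 ≤ e → e ≤ m → dist 1 (g ^ e) ≤ B := fun e h0 h1 =>
      hB _ (Finset.mem_image_of_mem _ (Finset.mem_Icc.2 ⟨h0, h1⟩))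
    obtain ⟨D, hD⟩ := hK (ρ + 2 * B)
    refine ⟨D + 2 * B, fun a => ?_⟩
    refine hD.pullback (fun x => g ^ (-a) * κ x * (g ^ (-a))⁻¹)
      (fun x hx => hg _ _ (hκ x hx.1)) ?_
    have hnear : ∀ x ∈ A ∩ {x | a ≤ f x ∧ f x ≤ a + m},
        dist (g ^ (-a) * κ x * (g ^ (-a))⁻¹) (g ^ (-a) * x) ≤ B := by
      rintro x ⟨hx, h1, h2⟩
      rw [dist_eq_dist_one hinv]
      have e1 : (g ^ (-a) * κ x * (g ^ (-a))⁻¹)⁻¹ * (g ^ (-a) * (κ x * g ^ f x)) =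
          g ^ (f x - a) := by
        group
      conv_lhs => rw [hf x hx]
      have e2 := hf x hx
      rw [← e2] at e1 ⊢
      rw [e1]
      exact hB' _ (by omega) (by omega)
    intro x hx y hy
    have h1 := hnear x hx
    have h2 := hnear y hy
    rw [← hinv (g ^ (-a)) x y]
    refine abs_le.2 ⟨?_, ?_⟩
    · have h3 := dist_triangle4 (g ^ (-a) * x) (g ^ (-a) * κ x * (g ^ (-a))⁻¹)
        (g ^ (-a) * κ y * (g ^ (-a))⁻¹) (g ^ (-a) * y)
      rw [dist_comm (g ^ (-a) * x) (g ^ (-a) * κ x * (g ^ (-a))⁻¹)] at h3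
      linarith
    · have h3 := dist_triangle4 (g ^ (-a) * κ x * (g ^ (-a))⁻¹) (g ^ (-a) * x) (g ^ (-a) * y)
        (g ^ (-a) * κ y * (g ^ (-a))⁻¹)
      rw [dist_comm (g ^ (-a) * y) (g ^ (-a) * κ y * (g ^ (-a))⁻¹)] at h3
      linarith

theorem CoarseDimLE.of_returnTimes_eq_univ (hinv : ∀ a x y : G, dist (a * x) (a * y) = dist x y)
    {K : Subgroup G} {g : G} {C : ℝ} (hC : ∀ e, e ∈ returnTimes K g C) {n : ℕ}
    (hK : CoarseDimLE (K : Set G) n) {A : Set G}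
    (hA : ∀ x ∈ A, ∃ k ∈ K, ∃ e : ℤ, x = k * g ^ e) : CoarseDimLE A n := by
  refine hK.of_near (C := C) fun x hx => ?_
  obtain ⟨k, hk, e, rfl⟩ := hA x hx
  obtain ⟨l, hl, h⟩ := hC e
  refine ⟨k * l⁻¹, K.mul_mem hk (K.inv_mem hl), ?_⟩
  rw [dist_comm, dist_eq_dist_one hinv]
  have e1 : (k * l⁻¹)⁻¹ * (k * g ^ e) = l * g ^ e := by group
  rwa [e1]

theorem PolycyclicSeries.coarseDimLE (hinv : ∀ a x y : G, dist (a * x) (a * y) = dist x y)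
    (hTB : TotallyBoundedBalls G) (s : PolycyclicSeries G) :
    CoarseDimLE (Set.univ : Set G) s.rankSum := by
  classical
  have key : ∀ i, CoarseDimLE (s.term i : Set G) (∑ j ∈ Finset.range i,
      if Infinite (↥(s.term (j + 1)) ⧸ (s.term j).subgroupOf (s.term (j + 1))) then 1 else 0) := by
    intro i
    induction i with
    | zero =>
      rw [s.term_zero]
      simpa using coarseDimLE_singleton (1 : G)
    | succ i ih =>
      have := s.normal i
      have := s.cyclic i
      obtain ⟨γ, hγ⟩ := IsCyclic.exists_generator
        (α := ↥(s.term (i + 1)) ⧸ (s.term i).subgroupOf (s.term (i + 1)))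
      obtain ⟨g, rfl⟩ := QuotientGroup.mk_surjective γ
      have hgK : ∀ e : ℤ, ∀ k ∈ s.term i, (g : G) ^ e * k * ((g : G) ^ e)⁻¹ ∈ s.term i := by
        intro e k hk
        have h1 := (s.normal i).conj_mem ⟨k, s.mono (Nat.le_succ i) hk⟩
          (Subgroup.mem_subgroupOf.2 hk) (g ^ e)
        simpa [Subgroup.mem_subgroupOf] using h1
      have hA : ∀ x ∈ (s.term (i + 1) : Set G), ∃ k ∈ s.term i, ∃ e : ℤ, x = k * (g : G) ^ e := by
        intro x hx
        obtain ⟨e, he⟩ := Subgroup.mem_zpowers_iff.1 (hγ (QuotientGroup.mk ⟨x, hx⟩))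
        rw [← QuotientGroup.mk_zpow, QuotientGroup.eq, Subgroup.mem_subgroupOf] at he
        have h2 := hgK e _ he
        refine ⟨_, h2, e, ?_⟩
        simp
      rw [Finset.sum_range_succ]
      rcases returnTimes_dichotomy hinv hTB (s.term i) g hgK with hfin | ⟨C, hC⟩
      · have hinf : Infinite (↥(s.term (i + 1)) ⧸ (s.term i).subgroupOf (s.term (i + 1))) := by
          by_contra hcon
          rw [not_infinite_iff_finite] at hcon
          obtain ⟨N, hN, hpow⟩ := isOfFinOrder_iff_pow_eq_one.1 (isOfFinOrder_of_finite
            (QuotientGroup.mk g : ↥(s.term (i + 1)) ⧸ (s.term i).subgroupOf (s.term (i + 1))))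
          rw [← QuotientGroup.mk_pow, QuotientGroup.eq_one_iff, Subgroup.mem_subgroupOf] at hpow
          have h1 := zpow_notMem_of_finite_returnTimes (hfin 0) (e := N) (by simpa using hpow)
          omega
        rw [if_pos hinf]
        exact ih.of_finite_returnTimes hinv hgK hfin hA
      · obtain ⟨D, hD⟩ : ∃ D : ℕ, D = if Infinite (↥(s.term (i + 1)) ⧸
            (s.term i).subgroupOf (s.term (i + 1))) then 1 else 0 := ⟨_, rfl⟩
        rw [← hD]
        refine CoarseDimLE.mono ?_ (Nat.le_add_right _ D)
        exact ih.of_returnTimes_eq_univ hinv hC hA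
  have := key s.length
  rwa [s.term_length, Subgroup.coe_top] at this

end Group

/-! ### Word metrics and finitely generated nilpotent groups -/

section Word

variable {G : Type u} [Group G]

theorem finite_setOf_wordNorm_le {S : Set G} (hS : S.Finite) (hgen : Subgroup.closure S = ⊤)
    (hinv : ∀ s ∈ S, s⁻¹ ∈ S) (n : ℕ) : {g | wordNorm S g ≤ n}.Finite := by
  have : Finite S := hS
  have h1 : {l : List S | l.length ≤ n}.Finite := List.finite_length_le S n
  refine (h1.image fun l => (l.map Subtype.val).prod).subset fun g hg => ?_
  obtain ⟨l, hl, hp, hn⟩ := exists_word hgen hinv g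
  refine ⟨l.attach.map fun s => ⟨s.1, hl s.1 s.2⟩, ?_, ?_⟩
  · simpa [hn] using hg
  · simp [List.map_map, Function.comp_def, hp]

theorem asdimWord_le_hirschLength {S : Set G} (hS : S.Finite)
    (hgen : Subgroup.closure S = ⊤) (hinv : ∀ s ∈ S, s⁻¹ ∈ S) :
    asdimWord S hgen hinv ≤ hirschLength G := by
  refine le_iInf fun s => ?_
  let _ := wordMetric S hgen hinv
  have hd : ∀ x y : G, dist x y = (wordNorm S (x⁻¹ * y) : ℝ) := fun _ _ => rfl
  refine asdim_le_of_coarseDimLE (PolycyclicSeries.coarseDimLE ?_ ?_ s)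
  · intro a x y
    rw [hd, hd]
    congr 2
    group
  · intro R ε hε
    refine ⟨(finite_setOf_wordNorm_le hS hgen hinv ⌊R⌋₊).toFinset, fun x hx => ⟨x, ?_, ?_⟩⟩
    · rw [hd, inv_one, one_mul] at hx
      simpa using Nat.le_floor hx
    · rw [dist_self]
      exact hε.le

end Word

section Nilpotent

open scoped commutatorElement

variable {G : Type u} [Group G]

/-- `H` is an extension of its normal subgroup `K` by a cyclic group. -/
def CyclicStep (K H : Subgroup G) : Prop :=
  K ≤ H ∧ ∃ g ∈ H, (∀ h ∈ H, ∀ k ∈ K, h * k * h⁻¹ ∈ K) ∧ ∀ x ∈ H, ∃ k ∈ K, ∃ e : ℤ, x = k * g ^ e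

theorem isPolycyclic_of_reflTransGen
    (h : Relation.ReflTransGen CyclicStep (⊥ : Subgroup G) ⊤) : IsPolycyclic G := by
  obtain ⟨n, term, h0, hn, hstep⟩ : ∃ (n : ℕ) (term : ℕ → Subgroup G), term 0 = ⊥ ∧
      (∀ i, n ≤ i → term i = ⊤) ∧ ∀ i < n, CyclicStep (term i) (term (i + 1)) := by
    have key : ∀ H : Subgroup G, Relation.ReflTransGen CyclicStep ⊥ H →
        ∃ (n : ℕ) (term : ℕ → Subgroup G), term 0 = ⊥ ∧
          (∀ i, n ≤ i → term i = H) ∧ ∀ i < n, CyclicStep (term i) (term (i + 1)) := by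
      intro H hH
      induction hH with
      | refl => exact ⟨0, fun _ => ⊥, rfl, fun _ _ => rfl, by simp⟩
      | @tail K H _ hKH ih =>
        obtain ⟨n, term, h0, hn, hstep⟩ := ih
        refine ⟨n + 1, fun i => if i ≤ n then term i else H, by simpa, ?_, ?_⟩
        · intro i hi
          simp [show ¬ i ≤ n by omega]
        · intro i hi
          rcases Nat.lt_succ_iff_lt_or_eq.1 hi with hi | rfl
          · simpa [hi.le, Nat.succ_le_of_lt hi] using hstep i hi
          · simpa [hn i le_rfl] using hKH
    exact key ⊤ h
  have hall : ∀ i, CyclicStep (term i) (term (i + 1)) := by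
    intro i
    by_cases hi : i < n
    · exact hstep i hi
    · rw [hn i (by omega), hn (i + 1) (by omega)]
      exact ⟨le_rfl, 1, Subgroup.mem_top _, fun _ _ _ _ => Subgroup.mem_top _,
        fun x _ => ⟨x, Subgroup.mem_top _, 0, by simp⟩⟩
  have hnormal : ∀ i, ((term i).subgroupOf (term (i + 1))).Normal := by
    intro i
    obtain ⟨-, g, -, hnorm, -⟩ := hall i
    refine ⟨fun k hk x => ?_⟩
    rw [Subgroup.mem_subgroupOf] at hk ⊢
    exact hnorm x x.2 k hk
  refine ⟨⟨n, term, h0, hn n le_rfl, monotone_nat_of_le_succ fun i => (hall i).1, hnormal, ?_⟩⟩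
  intro i
  have := hnormal i
  obtain ⟨-, g, hg, hnorm, hgen⟩ := hall i
  refine ⟨⟨QuotientGroup.mk ⟨g, hg⟩, fun q => ?_⟩⟩
  obtain ⟨x, rfl⟩ := QuotientGroup.mk_surjective q
  obtain ⟨k, hk, e, he⟩ := hgen x x.2
  refine Subgroup.mem_zpowers_iff.2 ⟨e, ?_⟩
  rw [← QuotientGroup.mk_zpow, QuotientGroup.eq, Subgroup.mem_subgroupOf]
  have h1 := hnorm (g ^ (-e)) (Subgroup.zpow_mem _ hg _) k hk
  simpa [he, mul_assoc] using h1

/-- If `H` is generated by `K` and finitely many elements, and `[H, H] ≤ K`, then `H` is obtained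
from `K` by finitely many cyclic extensions. -/
theorem reflTransGen_cyclicStep {K H : Subgroup G}
    (hcomm : ∀ x ∈ H, ∀ y ∈ H, x * y * x⁻¹ * y⁻¹ ∈ K) (Y : Finset G)
    (hY : H = K ⊔ Subgroup.closure (Y : Set G)) : Relation.ReflTransGen CyclicStep K H := by
  classical
  have key : ∀ Z : Finset G, Z ⊆ Y →
      Relation.ReflTransGen CyclicStep K (K ⊔ Subgroup.closure (Z : Set G)) := by
    intro Z
    induction Z using Finset.induction_on with
    | empty => intro _; simp [Relation.ReflTransGen.refl]
    | insert g Z _ ih =>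
      intro hZ
      have hZY : Z ⊆ Y := (Finset.subset_insert _ _).trans hZ
      refine (ih hZY).tail ?_
      set L := K ⊔ Subgroup.closure (Z : Set G) with hL
      have hLH : K ⊔ Subgroup.closure ((insert g Z : Finset G) : Set G) ≤ H := by
        rw [hY]
        exact sup_le_sup_left (Subgroup.closure_mono (by exact_mod_cast hZ)) _
      have hgM : g ∈ K ⊔ Subgroup.closure ((insert g Z : Finset G) : Set G) :=
        Subgroup.mem_sup_right (Subgroup.subset_closure (by simp))
      have hLM : L ≤ K ⊔ Subgroup.closure ((insert g Z : Finset G) : Set G) :=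
        sup_le_sup_left (Subgroup.closure_mono (by simp)) _
      have hnorm : ∀ h ∈ H, ∀ k ∈ L, h * k * h⁻¹ ∈ L := by
        intro h hh k hk
        have h1 : h * k * h⁻¹ * k⁻¹ ∈ L :=
          (le_sup_left : K ≤ L) (hcomm h hh k (hLH (hLM hk)))
        simpa using L.mul_mem h1 hk
      refine ⟨hLM, g, hgM, fun h hh => hnorm h (hLH hh), fun x hx => ?_⟩
      have hgH := hLH hgM
      let M : Subgroup G :=
        { carrier := {x | ∃ k ∈ L, ∃ e : ℤ, x = k * g ^ e}
          one_mem' := ⟨1, L.one_mem, 0, by simp⟩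
          mul_mem' := by
            rintro _ _ ⟨k, hk, e, rfl⟩ ⟨l, hl, f, rfl⟩
            refine ⟨k * (g ^ e * l * (g ^ e)⁻¹),
              L.mul_mem hk (hnorm _ (H.zpow_mem hgH e) _ hl), e + f, ?_⟩
            rw [zpow_add]
            group
          inv_mem' := by
            rintro _ ⟨k, hk, e, rfl⟩
            refine ⟨g ^ (-e) * k⁻¹ * (g ^ (-e))⁻¹, hnorm _ (H.zpow_mem hgH _) _ (L.inv_mem hk),
              -e, ?_⟩
            group }
      have hM : K ⊔ Subgroup.closure ((insert g Z : Finset G) : Set G) ≤ M := by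
        refine sup_le (fun k hk => ⟨k, Subgroup.mem_sup_left hk, 0, by simp⟩) ?_
        rw [Subgroup.closure_le]
        intro z hz
        rcases Finset.mem_insert.1 (Finset.mem_coe.1 hz) with rfl | hz
        · exact ⟨1, L.one_mem, 1, by simp⟩
        · exact ⟨z, Subgroup.mem_sup_right (Subgroup.subset_closure hz), 0, by simp⟩
      exact hM hx
  rw [hY]
  exact key Y subset_rfl

/-- The quotients of the lower central series of a finitely generated group are finitely
generated. -/
theorem exists_finset_lowerCentralSeries (X : Finset G) (hX : Subgroup.closure (X : Set G) = ⊤)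
    (i : ℕ) : ∃ Y : Finset G, (⊤ : Subgroup G).lowerCentralSeries i =
      (⊤ : Subgroup G).lowerCentralSeries (i + 1) ⊔ Subgroup.closure (Y : Set G) := by
  classical
  induction i with
  | zero => exact ⟨X, by simp [hX]⟩
  | succ i ih =>
    obtain ⟨Y, hY⟩ := ih
    let γ := (⊤ : Subgroup G).lowerCentralSeries
    have hγ : ∀ j, γ (j + 1) = ⁅γ j, ⊤⁆ := fun j => rfl
    have hanti : Antitone γ := Subgroup.lowerCentralSeries_antitone ⊤
    let Z : Finset G := (Y ×ˢ X).image fun t => ⁅t.1, t.2⁆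
    have hYγ : ∀ y ∈ Y, y ∈ γ i := fun y hy => by
      have : y ∈ γ (i + 1) ⊔ Subgroup.closure (Y : Set G) :=
        Subgroup.mem_sup_right (Subgroup.subset_closure hy)
      rwa [← hY] at this
    refine ⟨Z, le_antisymm ?_ ?_⟩
    · set M := γ (i + 2) ⊔ Subgroup.closure (Z : Set G) with hM
      have hM1 : M ≤ γ (i + 1) := by
        refine sup_le (hanti (by omega)) ?_
        rw [Subgroup.closure_le]
        intro z hz
        obtain ⟨⟨y, x⟩, hyx, rfl⟩ := Finset.mem_image.1 (Finset.mem_coe.1 hz)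
        rw [SetLike.mem_coe, hγ]
        exact Subgroup.commutator_mem_commutator (hYγ y (Finset.mem_product.1 hyx).1)
          (Subgroup.mem_top _)
      have hMn : M.Normal := ⟨fun m hm g => by
        have h1 : ⁅m, g⁆ ∈ M := (le_sup_left : γ (i + 2) ≤ M) (by
          rw [hγ]
          exact Subgroup.commutator_mem_commutator (hM1 hm) (Subgroup.mem_top _))
        have h2 : g * m * g⁻¹ = ⁅m, g⁆⁻¹ * m := by
          rw [commutatorElement_def]
          group
        rw [h2]
        exact M.mul_mem (M.inv_mem h1) hm⟩
      let C : Subgroup G := (Subgroup.center (G ⧸ M)).comap (QuotientGroup.mk' M)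
      have hC : ∀ x, x ∈ C ↔ ∀ g, ⁅x, g⁆ ∈ M := by
        intro x
        rw [Subgroup.mem_comap, Subgroup.mem_center_iff]
        have h3 : ∀ g : G, (QuotientGroup.mk' M g * QuotientGroup.mk' M x =
            QuotientGroup.mk' M x * QuotientGroup.mk' M g) ↔ ⁅x, g⁆ ∈ M := by
          intro g
          rw [← QuotientGroup.eq_one_iff, ← QuotientGroup.mk'_apply, map_commutatorElement,
            commutatorElement_eq_one_iff_mul_comm]
          exact eq_comm
        constructor
        · exact fun h g => (h3 g).1 (h _)
        · intro h q
          obtain ⟨g, rfl⟩ := QuotientGroup.mk_surjective q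
          exact (h3 g).2 (h g)
      have hle : γ i ≤ C := by
        have h4 : γ (i + 1) ≤ C := fun x hx => (hC x).2 fun g =>
          (le_sup_left : γ (i + 2) ≤ M) (by
            rw [hγ]
            exact Subgroup.commutator_mem_commutator hx (Subgroup.mem_top _))
        have h5 : Subgroup.closure (Y : Set G) ≤ C := by
          rw [Subgroup.closure_le]
          intro y hy
          refine (hC y).2 fun g => ?_
          have h6 : (⊤ : Subgroup G) ≤
              (Subgroup.centralizer {QuotientGroup.mk' M y}).comap (QuotientGroup.mk' M) := by
            rw [← hX, Subgroup.closure_le]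
            intro x hx
            have h7 : ⁅y, x⁆ ∈ M := Subgroup.mem_sup_right (Subgroup.subset_closure
              (Finset.mem_coe.2 (Finset.mem_image.2 ⟨(y, x), Finset.mem_product.2 ⟨hy, hx⟩, rfl⟩)))
            rw [← QuotientGroup.eq_one_iff, ← QuotientGroup.mk'_apply, map_commutatorElement,
              commutatorElement_eq_one_iff_mul_comm] at h7
            rw [SetLike.mem_coe, Subgroup.mem_comap, Subgroup.mem_centralizer_singleton_iff]
            exact h7.symm
          have h8 := h6 (Subgroup.mem_top g)
          rw [Subgroup.mem_comap, Subgroup.mem_centralizer_singleton_iff] at h8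
          rw [← QuotientGroup.eq_one_iff, ← QuotientGroup.mk'_apply, map_commutatorElement,
            commutatorElement_eq_one_iff_mul_comm]
          exact h8.symm
        change (⊤ : Subgroup G).lowerCentralSeries i ≤ C
        rw [hY]
        exact sup_le h4 h5
      change γ (i + 1) ≤ M
      rw [hγ, Subgroup.commutator_le]
      exact fun x hx g _ => (hC x).1 (hle hx) g
    · refine sup_le (hanti (by omega)) ?_
      rw [Subgroup.closure_le]
      intro z hz
      obtain ⟨⟨y, x⟩, hyx, rfl⟩ := Finset.mem_image.1 (Finset.mem_coe.1 hz)
      exact Subgroup.commutator_mem_commutator (hYγ y (Finset.mem_product.1 hyx).1)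
        (Subgroup.mem_top _)

theorem isPolycyclic_of_isNilpotent [Group.IsNilpotent G] {S : Set G} (hS : S.Finite)
    (hgen : Subgroup.closure S = ⊤) : IsPolycyclic G := by
  refine isPolycyclic_of_reflTransGen ?_
  obtain ⟨n, hn⟩ := Subgroup.nilpotent_iff_lowerCentralSeries.1 ‹Group.IsNilpotent G›
  have key : ∀ i, Relation.ReflTransGen CyclicStep ((⊤ : Subgroup G).lowerCentralSeries i) ⊤ := by
    intro i
    induction i with
    | zero => exact .refl
    | succ i ih =>
      obtain ⟨Y, hY⟩ := exists_finset_lowerCentralSeries hS.toFinset (by simpa using hgen) i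
      refine .trans (reflTransGen_cyclicStep (fun x hx y _ => ?_) Y hY) ih
      exact Subgroup.commutator_mem_commutator hx (Subgroup.mem_top y)
  exact hn ▸ key n

end Nilpotent

/-! ### Connected topological groups -/

section Topological

open scoped commutatorElement

variable {G : Type u} [Group G] [TopologicalSpace G] [IsTopologicalGroup G]

theorem isPreconnected_subgroupClosure {S : Set G} (hS : IsPreconnected S) (h1 : (1 : G) ∈ S) :
    IsPreconnected (Subgroup.closure S : Set G) := by
  refine isPreconnected_of_forall 1 fun x hx => ?_
  induction hx using Subgroup.closure_induction with
  | mem x hx => exact ⟨S, Subgroup.subset_closure, h1, hx, hS⟩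
  | one => exact ⟨{1}, by simp, rfl, rfl, isPreconnected_singleton⟩
  | mul x y hx _ ihx ihy =>
    obtain ⟨A, hA, hA1, hAx, hAp⟩ := ihx
    obtain ⟨B, hB, hB1, hBy, hBp⟩ := ihy
    refine ⟨A ∪ (x * ·) '' B, ?_, Or.inl hA1, Or.inr ⟨y, hBy, rfl⟩, ?_⟩
    · refine Set.union_subset hA ?_
      rintro _ ⟨b, hb, rfl⟩
      exact Subgroup.mul_mem _ hx (hB hb)
    · exact hAp.union x hAx ⟨1, hB1, mul_one x⟩
        (hBp.image _ (continuous_const_mul x).continuousOn)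
  | inv x hx ih =>
    obtain ⟨A, hA, hA1, hAx, hAp⟩ := ih
    refine ⟨(x⁻¹ * ·) '' A, ?_, ⟨x, hAx, inv_mul_cancel x⟩, ⟨1, hA1, mul_one _⟩,
      hAp.image _ (continuous_const_mul _).continuousOn⟩
    rintro _ ⟨b, hb, rfl⟩
    exact Subgroup.mul_mem _ (Subgroup.inv_mem _ hx) (hA hb)

theorem isPreconnected_lowerCentralSeries [ConnectedSpace G] (i : ℕ) :
    IsPreconnected ((⊤ : Subgroup G).lowerCentralSeries i : Set G) := by
  induction i with
  | zero => simpa using isPreconnected_univ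
  | succ i ih =>
    have h1 : {g | ∃ a ∈ (⊤ : Subgroup G).lowerCentralSeries i, ∃ b ∈ (⊤ : Subgroup G), ⁅a, b⁆ = g} =
        (fun t : G × G => t.1 * t.2 * t.1⁻¹ * t.2⁻¹) ''
          (((⊤ : Subgroup G).lowerCentralSeries i : Set G) ×ˢ Set.univ) := by
      ext g
      simp [commutatorElement_def]
    rw [Subgroup.lowerCentralSeries_succ, Subgroup.commutator_def, h1]
    refine isPreconnected_subgroupClosure ((ih.prod isPreconnected_univ).image _
      (by fun_prop)) ?_
    exact ⟨(1, 1), ⟨Subgroup.one_mem _, trivial⟩, by simp⟩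

theorem nonempty_connectedCentralSeries [T1Space G] [ConnectedSpace G] [Group.IsNilpotent G] :
    Nonempty (ConnectedCentralSeries G) := by
  obtain ⟨n, hn⟩ := Subgroup.nilpotent_iff_lowerCentralSeries.1 ‹Group.IsNilpotent G›
  let γ := (⊤ : Subgroup G).lowerCentralSeries
  have hcl : ∀ i, ⁅(γ i).topologicalClosure, (⊤ : Subgroup G)⁆ ≤ (γ (i + 1)).topologicalClosure := by
    intro i
    rw [Subgroup.commutator_le]
    intro x hx g _
    have hcont : Continuous fun x : G => ⁅x, g⁆ := by
      simp only [commutatorElement_def]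
      fun_prop
    exact map_mem_closure (f := fun x : G => ⁅x, g⁆) hcont hx fun y hy =>
      Subgroup.commutator_mem_commutator hy (Subgroup.mem_top g)
  refine ⟨{
    length := n
    term := fun i => (γ (n - i)).topologicalClosure
    term_zero := ?_
    term_length := ?_
    mono := ?_
    normal := ?_
    central := ?_
    isClosed := fun i => Subgroup.isClosed_topologicalClosure _
    isConnected := fun i => ⟨⟨1, Subgroup.one_mem _⟩,
      (isPreconnected_lowerCentralSeries (n - i)).closure⟩ }⟩
  · refine SetLike.coe_injective ?_
    simp [γ, hn]
  · refine top_unique ?_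
    simpa [γ] using Subgroup.le_topologicalClosure (⊤ : Subgroup G)
  · exact fun i j hij => closure_mono (Subgroup.lowerCentralSeries_antitone ⊤ (by omega))
  · intro i
    have : (γ (n - i)).Normal := inferInstanceAs ((⊤ : Subgroup G).lowerCentralSeries (n - i)).Normal
    exact Subgroup.is_normal_topologicalClosure _
  · intro i
    by_cases hi : i < n
    · have h1 := hcl (n - (i + 1))
      rwa [show n - (i + 1) + 1 = n - i by omega] at h1
    · have h1 : (⊤ : Subgroup G) ≤ (γ (n - i)).topologicalClosure := by
        rw [show n - i = 0 by omega]
        exact Subgroup.le_topologicalClosure (⊤ : Subgroup G)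
      exact le_top.trans h1

@[to_additive]
theorem subgroupClosure_eq_top_of_mem_nhds {G : Type*} [Group G] [TopologicalSpace G]
    [IsTopologicalGroup G] [ConnectedSpace G] {U : Set G} (hU : U ∈ nhds (1 : G)) :
    Subgroup.closure U = ⊤ := by
  have h1 : IsOpen (Subgroup.closure U : Set G) :=
    Subgroup.isOpen_of_mem_nhds _ (Filter.mem_of_superset hU Subgroup.subset_closure)
  have h2 : IsClopen (Subgroup.closure U : Set G) := ⟨Subgroup.isClosed_of_isOpen _ h1, h1⟩
  exact SetLike.coe_injective (h2.eq_univ ⟨1, Subgroup.one_mem _⟩)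

/-- A closed connected subgroup that spans a finite-dimensional real vector space is the whole
space. -/
theorem addSubgroup_eq_top_of_isConnected {V : Type*} [NormedAddCommGroup V] [NormedSpace ℝ V]
    [FiniteDimensional ℝ V] {T : AddSubgroup V} (hcl : IsClosed (T : Set V))
    (hconn : IsPreconnected (T : Set V)) (hspan : Submodule.span ℝ (T : Set V) = ⊤) : T = ⊤ := by
  have : ConnectedSpace T :=
    { isPreconnected_univ := (Subtype.preconnectedSpace hconn).isPreconnected_univ
      toNonempty := ⟨0⟩ }
  refine SetLike.coe_injective ?_
  rw [← hcl.closure_eq, AddSubgroup.coe_top, ← Set.univ_subset_iff]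
  intro x _
  rw [Metric.mem_closure_iff]
  intro ε hε
  set d := Module.finrank ℝ V with hd
  set δ : ℝ := ε / (d + 1) with hδ
  have hδpos : 0 < δ := by positivity
  have hgen := addSubgroupClosure_eq_top_of_mem_nhds (Metric.ball_mem_nhds (0 : T) hδpos)
  have hsub : (T : Set V) ⊆ Submodule.span ℝ ((T : Set V) ∩ Metric.ball 0 δ) := by
    intro t ht
    have h1 : (⟨t, ht⟩ : T) ∈ AddSubgroup.closure (Metric.ball (0 : T) δ) := by
      rw [hgen]
      trivial
    have h2 : AddSubgroup.closure (Metric.ball (0 : T) δ) ≤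
        (Submodule.span ℝ ((T : Set V) ∩ Metric.ball 0 δ)).toAddSubgroup.comap T.subtype := by
      rw [AddSubgroup.closure_le]
      intro s hs
      refine Submodule.subset_span ⟨s.2, ?_⟩
      simpa using hs
    exact h2 h1
  have hspan' : ⊤ ≤ Submodule.span ℝ ((T : Set V) ∩ Metric.ball 0 δ) := by
    rw [← hspan]
    exact Submodule.span_le.2 hsub
  let b := Module.Basis.ofSpan hspan'
  have hb : ∀ i, b i ∈ (T : Set V) ∩ Metric.ball 0 δ := fun i =>
    Module.Basis.ofSpan_subset hspan' ⟨i, rfl⟩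
  have : Fintype ((linearIndepOn_empty ℝ (id : V → V)).extend
      (Set.empty_subset ((T : Set V) ∩ Metric.ball 0 δ))) :=
    FiniteDimensional.fintypeBasisIndex b
  refine ⟨(ZSpan.floor b x : V), ?_, ?_⟩
  · have h1 : Submodule.span ℤ (Set.range b) ≤ AddSubgroup.toIntSubmodule T := by
      rw [Submodule.span_le]
      rintro _ ⟨i, rfl⟩
      exact (hb i).1
    exact h1 (ZSpan.floor b x).2
  · have h1 := ZSpan.norm_fract_le b x
    rw [ZSpan.fract_apply] at h1
    rw [dist_eq_norm]
    have h2 : ∑ i, ‖b i‖ ≤ d * δ := by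
      refine (Finset.sum_le_sum (g := fun _ => δ) fun i _ => ?_).trans ?_
      · simpa using (mem_ball_zero_iff.1 (hb i).2).le
      · simp [hd, Module.finrank_eq_card_basis b]
    have h3 : d * δ < ε := by
      rw [hδ, mul_div_assoc', div_lt_iff₀ (by positivity)]
      nlinarith
    linarith

end Topological

/-! ### Lattices in abelian groups with a length filtration -/

/-- A function that is additive up to a bounded error is at bounded distance from an additive
function. -/
theorem exists_addMonoidHom_near {Q V : Type*} [AddCommGroup Q] [NormedAddCommGroup V]
    [NormedSpace ℝ V] [CompleteSpace V] (f : Q → V) {B : ℝ}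
    (hf : ∀ x y, ‖f (x + y) - f x - f y‖ ≤ B) : ∃ F : Q →+ V, ∀ x, ‖F x - f x‖ ≤ B := by
  let a : Q → ℕ → V := fun x n => ((2 : ℝ) ^ n)⁻¹ • f (2 ^ n • x)
  have hstep : ∀ x n, dist (a x n) (a x (n + 1)) ≤ B / 2 / 2 ^ n := by
    intro x n
    have h1 : a x n - a x (n + 1) =
        -(((2 : ℝ) ^ (n + 1))⁻¹ • (f (2 ^ n • x + 2 ^ n • x) - f (2 ^ n • x) - f (2 ^ n • x))) := by
      have h2 : ((2 : ℝ) ^ n)⁻¹ = ((2 : ℝ) ^ (n + 1))⁻¹ + ((2 : ℝ) ^ (n + 1))⁻¹ := by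
        rw [pow_succ]
        field_simp
        norm_num
      have h3 : 2 ^ (n + 1) • x = 2 ^ n • x + 2 ^ n • x := by rw [pow_succ, mul_smul, two_smul,
        smul_add]
      simp only [a, h3]
      rw [h2, add_smul]
      simp only [smul_sub]
      abel
    rw [dist_eq_norm, h1, norm_neg, norm_smul, norm_inv, norm_pow, Real.norm_two]
    have h4 := hf (2 ^ n • x) (2 ^ n • x)
    calc ((2 : ℝ) ^ (n + 1))⁻¹ * _ ≤ ((2 : ℝ) ^ (n + 1))⁻¹ * B := by gcongr
      _ = B / 2 / 2 ^ n := by rw [pow_succ]; field_simp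
  have hlim : ∀ x, ∃ l, Filter.Tendsto (a x) Filter.atTop (nhds l) := fun x =>
    cauchySeq_tendsto_of_complete (cauchySeq_of_le_geometric_two (hstep x))
  choose F hF using hlim
  refine ⟨AddMonoidHom.mk' F fun x y => ?_, fun x => ?_⟩
  · have h1 : Filter.Tendsto (fun n => a (x + y) n - a x n - a y n) Filter.atTop
        (nhds (F (x + y) - F x - F y)) := ((hF _).sub (hF x)).sub (hF y)
    have h2 : Filter.Tendsto (fun n => a (x + y) n - a x n - a y n) Filter.atTop (nhds 0) := by
      refine squeeze_zero_norm (a := fun n => B * ((1 : ℝ) / 2) ^ n) (fun n => ?_) ?_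
      · have h3 : a (x + y) n - a x n - a y n = ((2 : ℝ) ^ n)⁻¹ •
            (f (2 ^ n • x + 2 ^ n • y) - f (2 ^ n • x) - f (2 ^ n • y)) := by
          simp only [a, smul_add, smul_sub]
        rw [h3, norm_smul, norm_inv, norm_pow, Real.norm_two, one_div, inv_pow, mul_comm]
        gcongr
        exact hf _ _
      · simpa using (tendsto_pow_atTop_nhds_zero_of_lt_one (by norm_num : (0 : ℝ) ≤ 1 / 2)
          (by norm_num)).const_mul B
    have h3 := tendsto_nhds_unique h1 h2
    rw [sub_sub, sub_eq_zero] at h3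
    exact h3
  · have h1 := dist_le_of_le_geometric_two_of_tendsto₀ (hstep x) (hF x)
    rw [dist_comm, dist_eq_norm] at h1
    simpa [a] using h1

/-- The sets `b R` behave like totally bounded balls of radius `R` around `0`. -/
structure IsBallFiltration {Q : Type*} [AddCommGroup Q] (b : ℝ → Set Q) : Prop where
  neg_mem : ∀ R, ∀ x ∈ b R, -x ∈ b R
  add_mem : ∀ R S, ∀ x ∈ b R, ∀ y ∈ b S, x + y ∈ b (R + S)
  mono : Monotone b
  exhaust : ∀ x, ∃ R, x ∈ b R
  totallyBounded : ∀ R ε, 0 < ε → ∃ F : Finset Q, ∀ x ∈ b R, ∃ y ∈ F, x - y ∈ b ε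

namespace IsBallFiltration

variable {Q : Type*} [AddCommGroup Q] {b : ℝ → Set Q}

theorem sub_mem (hb : IsBallFiltration b) {R S : ℝ} {x y : Q} (hx : x ∈ b R) (hy : y ∈ b S) : x - y ∈ b (R + S) := by
  rw [sub_eq_add_neg]
  exact hb.add_mem _ _ _ hx _ (hb.neg_mem _ _ hy)

theorem zsmul_dichotomy (hb : IsBallFiltration b) (L : AddSubgroup Q) (g : Q) :
    (∀ R, {e : ℤ | ∃ l ∈ L, e • g + l ∈ b R}.Finite) ∨
      ∃ C, ∀ e : ℤ, ∃ l ∈ L, e • g + l ∈ b C := by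
  classical
  refine int_filtration_dichotomy (fun R => {e : ℤ | ∃ l ∈ L, e • g + l ∈ b R}) ?_ ?_ ?_ ?_ ?_
  · rintro R e ⟨l, hl, h⟩
    refine ⟨-l, L.neg_mem hl, ?_⟩
    have := hb.neg_mem _ _ h
    rwa [neg_add, ← neg_zsmul] at this
  · rintro R S e ⟨l, hl, h⟩ f ⟨l', hl', h'⟩
    refine ⟨l + l', L.add_mem hl hl', ?_⟩
    have := hb.add_mem _ _ _ h _ h'
    rwa [add_add_add_comm, ← add_zsmul] at this
  · rintro R S hRS e ⟨l, hl, h⟩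
    exact ⟨l, hl, hb.mono hRS h⟩
  · intro e
    obtain ⟨R, hR⟩ := hb.exhaust (e • g)
    exact ⟨R, 0, L.zero_mem, by rwa [add_zero]⟩
  · intro R ε hε
    obtain ⟨F, hF⟩ := hb.totallyBounded R (ε / 2) (by positivity)
    let φ : Q → ℤ := fun y =>
      if h : ∃ e : ℤ, ∃ l ∈ L, e • g + l - y ∈ b (ε / 2) then h.choose else 0
    refine ⟨F.image φ, ?_⟩
    rintro e ⟨l, hl, h⟩
    obtain ⟨y, hy, hyd⟩ := hF _ h
    refine ⟨φ y, Finset.mem_image_of_mem _ hy, ?_⟩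
    have hex : ∃ e : ℤ, ∃ l ∈ L, e • g + l - y ∈ b (ε / 2) := ⟨e, l, hl, hyd⟩
    simp only [φ, dif_pos hex]
    obtain ⟨l', hl', hd⟩ := hex.choose_spec
    generalize hex.choose = i at hd
    refine ⟨l - l', L.sub_mem hl hl', ?_⟩
    have h1 := hb.sub_mem hyd hd
    rw [add_halves] at h1
    rw [sub_zsmul]
    convert h1 using 1
    abel

/-- A finitely generated subgroup is at bounded distance from the image of a proper homomorphism
from some `ℤᵐ`. -/
theorem exists_lattice_near_closure (hb : IsBallFiltration b) (F : Finset Q) :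
    ∃ (m : ℕ) (φ : (Fin m → ℤ) →+ Q), (∀ R, {v | φ v ∈ b R}.Finite) ∧
      ∃ C, ∀ x ∈ AddSubgroup.closure (F : Set Q), ∃ v, x - φ v ∈ b C := by
  classical
  induction F using Finset.induction_on with
  | empty =>
    obtain ⟨C, hC⟩ := hb.exhaust 0
    refine ⟨0, 0, fun R => Set.toFinite _, C, fun x hx => ⟨0, ?_⟩⟩
    have : x = 0 := by simpa using hx
    simpa [this] using hC
  | insert g F _ ih =>
    obtain ⟨m, φ, hφ, C, hC⟩ := ih
    have hsplit : ∀ x ∈ AddSubgroup.closure ((insert g F : Finset Q) : Set Q),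
        ∃ e : ℤ, ∃ y ∈ AddSubgroup.closure (F : Set Q), x = e • g + y := by
      intro x hx
      rw [Finset.coe_insert, Set.insert_eq, AddSubgroup.closure_union, AddSubgroup.mem_sup] at hx
      obtain ⟨y, hy, z, hz, rfl⟩ := hx
      obtain ⟨e, rfl⟩ := AddSubgroup.mem_closure_singleton.1 hy
      exact ⟨e, z, hz, rfl⟩
    rcases hb.zsmul_dichotomy φ.range g with hfin | ⟨C', hC'⟩
    · let φ' : (Fin (m + 1) → ℤ) →+ Q := AddMonoidHom.mk' (fun v => v 0 • g + φ (fun i => v i.succ))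
        fun v w => by
          rw [add_add_add_comm, ← add_zsmul, ← map_add]
          rfl
      refine ⟨m + 1, φ', fun R => ?_, C, fun x hx => ?_⟩
      · choose S hS using fun e : ℤ => hb.exhaust (e • g)
        refine (Set.Finite.biUnion (t := fun e => (fun v => (Fin.cons e v : Fin (m + 1) → ℤ)) ''
          {v | φ v ∈ b (R + S e)}) (hfin R) fun e _ => (hφ (R + S e)).image _).subset ?_
        intro v hv
        have hv' : v 0 • g + φ (fun i => v i.succ) ∈ b R := hv
        refine Set.mem_biUnion (x := v 0) ⟨_, ⟨_, rfl⟩, hv'⟩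
          ⟨fun i => v i.succ, ?_, Fin.cons_self_tail v⟩
        have h1 := hb.sub_mem hv' (hS (v 0))
        rwa [add_sub_cancel_left] at h1
      · obtain ⟨e, y, hy, rfl⟩ := hsplit x hx
        obtain ⟨v, hv⟩ := hC y hy
        refine ⟨Fin.cons e v, ?_⟩
        have h1 : φ' (Fin.cons e v) = e • g + φ v := rfl
        rwa [h1, add_sub_add_left_eq_sub]
    · refine ⟨m, φ, hφ, C' + C, fun x hx => ?_⟩
      obtain ⟨e, y, hy, rfl⟩ := hsplit x hx
      obtain ⟨v, hv⟩ := hC y hy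
      obtain ⟨_, ⟨w, rfl⟩, hw⟩ := hC' e
      refine ⟨v - w, ?_⟩
      have h1 := hb.add_mem _ _ _ hw _ hv
      rw [map_sub]
      convert h1 using 1
      abel

theorem exists_lattice (hb : IsBallFiltration b) {S : ℝ} (hS : 0 < S) (hgen : AddSubgroup.closure (b S) = ⊤) :
    ∃ (m : ℕ) (φ : (Fin m → ℤ) →+ Q), (∀ R, {v | φ v ∈ b R}.Finite) ∧
      ∃ C, ∀ x, ∃ v, x - φ v ∈ b C := by
  obtain ⟨R, hR⟩ := hb.exhaust 0
  set ρ := max R S with hρ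
  have hSρ : b S ⊆ b ρ := hb.mono (le_max_right _ _)
  obtain ⟨F, hF⟩ := hb.totallyBounded (ρ + S) ρ (lt_max_of_lt_right hS)
  obtain ⟨m, φ, hφ, C, hC⟩ := hb.exists_lattice_near_closure F
  have hstep : ∀ q, (∃ x ∈ AddSubgroup.closure (F : Set Q), q - x ∈ b ρ) → ∀ t ∈ b S,
      ∃ x ∈ AddSubgroup.closure (F : Set Q), q + t - x ∈ b ρ := by
    rintro q ⟨x, hx, hq⟩ t ht
    obtain ⟨y, hy, h1⟩ := hF _ (hb.add_mem _ _ _ hq _ ht)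
    refine ⟨x + y, AddSubgroup.add_mem _ hx (AddSubgroup.subset_closure hy), ?_⟩
    convert h1 using 1
    abel
  have hnear : ∀ q, ∃ x ∈ AddSubgroup.closure (F : Set Q), q - x ∈ b ρ := by
    intro q
    have hq : q ∈ AddSubgroup.closure (b S) := by
      rw [hgen]
      trivial
    induction hq using AddSubgroup.closure_induction_right with
    | zero => exact ⟨0, AddSubgroup.zero_mem _, by simpa using hb.mono (le_max_left R S) hR⟩
    | add_right x _ y hy ih => exact hstep x ih y hy
    | add_neg_cancel x _ y hy ih => exact hstep x ih (-y) (hb.neg_mem _ _ hy)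
  refine ⟨m, φ, hφ, ρ + C, fun q => ?_⟩
  obtain ⟨x, hx, h1⟩ := hnear q
  obtain ⟨v, hv⟩ := hC x hx
  refine ⟨v, ?_⟩
  have h2 := hb.add_mem _ _ _ h1 _ hv
  rwa [sub_add_sub_cancel] at h2

/-- A proper homomorphism `φ : ℤᵐ → Q` with image at bounded distance from `Q` has a left inverse
with values in `ℝᵐ` that is bounded on bounded sets. -/
theorem exists_real_leftInverse (hb : IsBallFiltration b) {m : ℕ} (φ : (Fin m → ℤ) →+ Q)
    (hφ : ∀ R, {v | φ v ∈ b R}.Finite) {C : ℝ} (hC : ∀ x, ∃ v, x - φ v ∈ b C) :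
    ∃ Ψ : Q →+ (Fin m → ℝ), (∀ v, Ψ (φ v) = fun i => (v i : ℝ)) ∧
      ∀ R, ∃ B, ∀ x ∈ b R, ‖Ψ x‖ ≤ B := by
  let ι : (Fin m → ℤ) →+ (Fin m → ℝ) := AddMonoidHom.mk' (fun v i => (v i : ℝ)) fun v w => by
    ext i
    simp
  choose e he using hC
  have hbd : ∀ R, ∃ B, ∀ v, φ v ∈ b R → ‖ι v‖ ≤ B := by
    intro R
    obtain ⟨B, hB⟩ := ((hφ R).image fun v => ‖ι v‖).bddAbove
    exact ⟨B, fun v hv => hB ⟨v, hv, rfl⟩⟩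
  obtain ⟨B, hB⟩ := hbd (C + C + C)
  obtain ⟨Ψ, hΨ⟩ := exists_addMonoidHom_near (fun x => ι (e x)) (B := B) fun x y => by
    rw [← map_sub, ← map_sub]
    refine hB _ ?_
    have h1 := hb.sub_mem (hb.add_mem _ _ _ (he x) _ (he y)) (he (x + y))
    rw [map_sub, map_sub]
    convert h1 using 1
    abel
  refine ⟨Ψ, fun v => ?_, fun R => ?_⟩
  · obtain ⟨B', hB'⟩ := hbd C
    have h1 : ∀ v, ‖Ψ (φ v) - ι v‖ ≤ B + B' := by
      intro v
      have h2 := hΨ (φ v)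
      have h3 : ‖ι (v - e (φ v))‖ ≤ B' := hB' _ (by
        rw [map_sub]
        exact he (φ v))
      rw [map_sub] at h3
      have h4 : Ψ (φ v) - ι v = (Ψ (φ v) - ι (e (φ v))) - (ι v - ι (e (φ v))) := by abel
      rw [h4]
      exact (norm_sub_le _ _).trans (add_le_add h2 h3)
    by_contra hne
    have hpos : 0 < ‖Ψ (φ v) - ι v‖ := norm_pos_iff.2 (sub_ne_zero.2 hne)
    obtain ⟨k, hk⟩ := Archimedean.arch (B + B' + 1) hpos
    have h2 := h1 (k • v)
    rw [map_nsmul, map_nsmul, map_nsmul, ← nsmul_sub, ← Nat.cast_smul_eq_nsmul ℝ, norm_smul,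
      Real.norm_natCast] at h2
    rw [nsmul_eq_mul] at hk
    linarith
  · obtain ⟨B', hB'⟩ := hbd (R + C)
    refine ⟨B + B', fun x hx => ?_⟩
    have h1 := hB' (e x) (by
      have h2 := hb.sub_mem hx (he x)
      rwa [sub_sub_cancel] at h2)
    have h3 : Ψ x = (Ψ x - ι (e x)) + ι (e x) := by abel
    rw [h3]
    exact (norm_add_le _ _).trans (add_le_add (hΨ x) h1)

end IsBallFiltration

section AbelianQuotient

variable {H : Type u} [Group H] [PseudoMetricSpace H] {Q : Type*} [AddCommGroup Q]

/-- The image of the ball of radius `R` under a homomorphism. -/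
def ballImage (π : H →* Multiplicative Q) (R : ℝ) : Set Q :=
  {q | ∃ x, (π x).toAdd = q ∧ dist 1 x ≤ R}

theorem isBallFiltration_ballImage (hinv : ∀ a x y : H, dist (a * x) (a * y) = dist x y)
    (hTB : TotallyBoundedBalls H) {π : H →* Multiplicative Q} (hπ : Function.Surjective π) :
    IsBallFiltration (ballImage π) where
  neg_mem := by
    rintro R _ ⟨x, rfl, hx⟩
    exact ⟨x⁻¹, by simp, by rwa [dist_one_inv hinv]⟩
  add_mem := by
    rintro R S _ ⟨x, rfl, hx⟩ _ ⟨y, rfl, hy⟩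
    exact ⟨x * y, by simp, (dist_one_mul_le hinv x y).trans (add_le_add hx hy)⟩
  mono := by
    rintro R S hRS _ ⟨x, rfl, hx⟩
    exact ⟨x, rfl, hx.trans hRS⟩
  exhaust q := by
    obtain ⟨x, hx⟩ := hπ (Multiplicative.ofAdd q)
    exact ⟨dist 1 x, x, by rw [hx, toAdd_ofAdd], le_rfl⟩
  totallyBounded R ε hε := by
    classical
    obtain ⟨F, hF⟩ := hTB R ε hε
    refine ⟨F.image fun x => (π x).toAdd, ?_⟩
    rintro _ ⟨x, rfl, hx⟩
    obtain ⟨y, hy, hd⟩ := hF x hx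
    refine ⟨_, Finset.mem_image_of_mem _ hy, y⁻¹ * x, ?_, ?_⟩
    · rw [map_mul, toAdd_mul, map_inv, toAdd_inv]
      abel
    · rwa [← dist_eq_dist_one hinv]

/-- A proper homomorphism from `ℤᵐ` to an abelian quotient raises the dimension by at most `m`. -/
theorem coarseDimLE_preimage_range (hinv : ∀ a x y : H, dist (a * x) (a * y) = dist x y)
    {π : H →* Multiplicative Q} (hπ : Function.Surjective π) {n : ℕ}
    (hK : CoarseDimLE (π.ker : Set H) n) {m : ℕ} (φ : (Fin m → ℤ) →+ Q)
    (hφ : ∀ R, {v | φ v ∈ ballImage π R}.Finite) :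
    CoarseDimLE {x | ∃ v, (π x).toAdd = φ v} (n + m) := by
  induction m with
  | zero =>
    rw [add_zero]
    convert hK using 1
    ext x
    constructor
    · rintro ⟨v, hv⟩
      rw [Subsingleton.elim v 0, map_zero] at hv
      exact hv
    · intro hx
      exact ⟨0, by rw [map_zero]; exact hx⟩
  | succ m ih =>
    let φ' : (Fin m → ℤ) →+ Q := AddMonoidHom.mk' (fun v => φ (Fin.cons 0 v)) fun v w => by
      rw [← map_add, ← Matrix.vecCons, ← Matrix.vecCons, ← Matrix.vecCons, Matrix.cons_add_cons,
        add_zero]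
    have hφ' : ∀ R, {v | φ' v ∈ ballImage π R}.Finite := fun R =>
      Set.Finite.preimage (f := fun v : Fin m → ℤ => (Fin.cons 0 v : Fin (m + 1) → ℤ))
        (fun _ _ _ _ h => (Fin.cons_inj.1 h).2) (hφ R)
    let L : Subgroup H :=
      { carrier := {x | ∃ v, (π x).toAdd = φ' v}
        one_mem' := ⟨0, by rw [map_zero, map_one, toAdd_one]⟩
        mul_mem' := by
          rintro x y ⟨v, hv⟩ ⟨w, hw⟩
          exact ⟨v + w, by rw [map_mul, toAdd_mul, hv, hw, map_add]⟩
        inv_mem' := by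
          rintro x ⟨v, hv⟩
          exact ⟨-v, by rw [map_inv, toAdd_inv, hv, map_neg]⟩ }
    obtain ⟨g, hg⟩ := hπ (Multiplicative.ofAdd (φ (Fin.cons 1 0)))
    have hge : ∀ e : ℤ, (π (g ^ e)).toAdd = φ (Fin.cons e 0) := by
      intro e
      rw [map_zpow, toAdd_zpow, hg, toAdd_ofAdd, ← map_zsmul]
      congr 1
      ext i
      refine Fin.cases ?_ (fun j => ?_) i <;> simp
    have hsplit : ∀ (e : ℤ) (v : Fin m → ℤ), φ (Fin.cons e v) = φ' v + φ (Fin.cons e 0) := by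
      intro e v
      change _ = φ (Fin.cons 0 v) + _
      rw [← map_add]
      congr 1
      ext i
      refine Fin.cases ?_ (fun j => ?_) i <;> simp
    refine CoarseDimLE.of_finite_returnTimes hinv (K := L) (g := g) ?_ (fun R => ?_) (ih φ' hφ') ?_
    · rintro e x ⟨v, hv⟩
      refine ⟨v, ?_⟩
      have h1 : π (g ^ e * x * (g ^ e)⁻¹) = π x := by
        rw [map_mul, map_mul, map_inv, mul_comm (π (g ^ e)), mul_inv_cancel_right]
      rw [h1, hv]
    · refine ((hφ R).image fun v => v 0).subset ?_
      rintro e ⟨x, ⟨v, hv⟩, hx⟩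
      refine ⟨Fin.cons e v, ⟨x * g ^ e, ?_, hx⟩, rfl⟩
      rw [map_mul, toAdd_mul, hv, hge, hsplit e v]
    · rintro x ⟨v, hv⟩
      refine ⟨x * (g ^ v 0)⁻¹, ⟨fun i => v i.succ, ?_⟩, v 0, by simp⟩
      rw [map_mul, map_inv, toAdd_mul, toAdd_inv, hge, hv, ← sub_eq_add_neg, sub_eq_iff_eq_add,
        ← hsplit]
      congr 1
      exact (Fin.cons_self_tail v).symm

end AbelianQuotient

section ProperGroup

open scoped Pointwise

theorem totallyBoundedBalls_of_properSpace {H : Type*} [Group H] [PseudoMetricSpace H]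
    [ProperSpace H] : TotallyBoundedBalls H := by
  intro R ε hε
  obtain ⟨t, ht, hfin, hcov⟩ := (isCompact_closedBall (1 : H) R).finite_cover_balls hε
  refine ⟨hfin.toFinset, fun x hx => ?_⟩
  obtain ⟨y, hy, hxy⟩ := Set.mem_iUnion₂.1 (hcov (Metric.mem_closedBall'.2 hx))
  exact ⟨y, hfin.mem_toFinset.2 hy, (Metric.mem_ball'.1 hxy).le⟩

variable {H : Type u} [Group H] [PseudoMetricSpace H] [IsTopologicalGroup H]

/-- A homomorphism to a normed space that is bounded on balls is continuous. -/
theorem continuous_of_bounded_on_balls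
    (hinv : ∀ a x y : H, dist (a * x) (a * y) = dist x y) {V : Type*} [NormedAddCommGroup V]
    [NormedSpace ℝ V] (f : H →* Multiplicative V)
    (hf : ∀ R, ∃ B, ∀ x, dist 1 x ≤ R → ‖(f x).toAdd‖ ≤ B) : Continuous f := by
  refine continuous_of_continuousAt_one f ?_
  obtain ⟨B, hB⟩ := hf 1
  have hpow : ∀ (k : ℕ) (x : H), dist 1 (x ^ k) ≤ k * dist 1 x := by
    intro k x
    induction k with
    | zero => simp
    | succ k ih =>
      rw [pow_succ]
      refine (dist_one_mul_le hinv _ _).trans ?_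
      push_cast
      linarith
  have hB0 : 0 ≤ B := (norm_nonneg _).trans (hB 1 (by simp))
  have key : Filter.Tendsto (fun x => (f x).toAdd) (nhds 1) (nhds (0 : V)) := by
    rw [Metric.tendsto_nhds_nhds]
    intro ε hε
    obtain ⟨k, hk⟩ := exists_nat_gt (B / ε)
    have hk0 : (0 : ℝ) < k := (div_nonneg hB0 hε.le).trans_lt hk
    refine ⟨1 / k, by positivity, fun {x} hx => ?_⟩
    have h1 : dist 1 (x ^ k) ≤ 1 := by
      refine (hpow k x).trans ?_
      rw [dist_comm] at hx
      rw [lt_div_iff₀ hk0] at hx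
      linarith
    have h2 := hB _ h1
    rw [map_pow, toAdd_pow, ← Nat.cast_smul_eq_nsmul ℝ, norm_smul, Real.norm_natCast] at h2
    rw [dist_zero_right]
    rw [div_lt_iff₀ hε] at hk
    exact lt_of_mul_lt_mul_left (h2.trans_lt hk) hk0.le
  have h3 : ContinuousAt (fun x => Multiplicative.ofAdd (f x).toAdd) 1 := by
    refine continuous_ofAdd.continuousAt.comp ?_
    rw [ContinuousAt, map_one, toAdd_one]
    exact key
  exact h3

/-- For a connected group `H` with a proper left-invariant metric and a normal subgroup `K` with
abelian quotient, the dimension of `H` exceeds that of `K` by at most the real rank of `H / K`. -/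
theorem exists_realRank_bound [ProperSpace H] [ConnectedSpace H]
    (hinv : ∀ a x y : H, dist (a * x) (a * y) = dist x y) (K : Subgroup H) [K.Normal]
    (hcomm : ∀ x y : H, x * y * x⁻¹ * y⁻¹ ∈ K) :
    ∃ m : ℕ, (m : ℕ∞) ≤ realRank (H ⧸ K) ∧
      ∀ n, CoarseDimLE (K : Set H) n → CoarseDimLE (Set.univ : Set H) (n + m) := by
  let _ : CommGroup (H ⧸ K) :=
    { (inferInstance : Group (H ⧸ K)) with
      mul_comm := fun a b => by
        obtain ⟨x, rfl⟩ := QuotientGroup.mk_surjective a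
        obtain ⟨y, rfl⟩ := QuotientGroup.mk_surjective b
        rw [← QuotientGroup.mk_mul, ← QuotientGroup.mk_mul, QuotientGroup.eq]
        have h := hcomm y⁻¹ x⁻¹
        simpa [mul_assoc] using h }
  let π : H →* Multiplicative (Additive (H ⧸ K)) :=
    (MulEquiv.multiplicativeAdditive (H ⧸ K)).symm.toMonoidHom.comp (QuotientGroup.mk' K)
  have hπmk : ∀ x, (π x).toAdd = Additive.ofMul (QuotientGroup.mk x : H ⧸ K) := fun x => rfl
  have hπs : Function.Surjective π := QuotientGroup.mk_surjective
  have hker : π.ker = K := by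
    ext x
    rw [MonoidHom.mem_ker, ← QuotientGroup.eq_one_iff]
    rfl
  have hTB : TotallyBoundedBalls H := totallyBoundedBalls_of_properSpace
  have hb := isBallFiltration_ballImage hinv hTB hπs
  have hgen : AddSubgroup.closure (ballImage π 1) = ⊤ := by
    have h1 := subgroupClosure_eq_top_of_mem_nhds (Metric.closedBall_mem_nhds (1 : H) one_pos)
    refine top_unique fun q _ => ?_
    obtain ⟨x, rfl⟩ := QuotientGroup.mk_surjective q.toMul
    have h2 : Subgroup.closure (Metric.closedBall (1 : H) 1) ≤
        (AddSubgroup.toSubgroup (AddSubgroup.closure (ballImage π 1))).comap π := by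
      rw [Subgroup.closure_le]
      intro y hy
      exact AddSubgroup.subset_closure ⟨y, rfl, Metric.mem_closedBall'.1 hy⟩
    rw [h1] at h2
    exact h2 (Subgroup.mem_top x)
  obtain ⟨m, φ, hφ, C, hC⟩ := hb.exists_lattice one_pos hgen
  obtain ⟨Ψ, hΨφ, hΨb⟩ := hb.exists_real_leftInverse φ hφ hC
  refine ⟨m, ?_, fun n hn => ?_⟩
  · let f : H ⧸ K →* Multiplicative (Fin m → ℝ) :=
      MonoidHom.mk' (fun q => Multiplicative.ofAdd (Ψ (Additive.ofMul q))) fun a b => by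
        rw [ofMul_mul, map_add, ofAdd_add]
    have hfc : Continuous (f.comp (QuotientGroup.mk' K)) := by
      refine continuous_of_bounded_on_balls hinv _ fun R => ?_
      obtain ⟨B, hB⟩ := hΨb R
      exact ⟨B, fun x hx => hB _ ⟨x, rfl, hx⟩⟩
    refine le_iSup₂_of_le m ⟨f, ?_, ?_⟩ le_rfl
    · exact (QuotientGroup.isQuotientMap_mk (N := K)).continuous_iff.2 hfc
    · have hc : Continuous fun x : H => Ψ (π x).toAdd := continuous_toAdd.comp hfc
      have himage : (Ψ.range : Set (Fin m → ℝ)) = Set.range fun x : H => Ψ (π x).toAdd := by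
        ext v
        constructor
        · rintro ⟨q, rfl⟩
          obtain ⟨x, hx⟩ := hπs (Multiplicative.ofAdd q)
          exact ⟨x, by simp only [hx, toAdd_ofAdd]⟩
        · rintro ⟨x, rfl⟩
          exact ⟨_, rfl⟩
      let Λ : Set (Fin m → ℝ) := Set.univ.pi fun _ => Set.range ((↑) : ℤ → ℝ)
      have hΛ : IsClosed Λ :=
        isClosed_set_pi fun _ _ => Int.isClosedEmbedding_coe_real.isClosed_range
      have hsum : (Ψ.range : Set (Fin m → ℝ)) =
          Λ + (fun x : H => Ψ (π x).toAdd) '' Metric.closedBall 1 C := by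
        refine subset_antisymm ?_ ?_
        · rintro _ ⟨q, rfl⟩
          obtain ⟨v, c, hc, hcd⟩ := hC q
          refine ⟨fun i => (v i : ℝ), fun i _ => ⟨v i, rfl⟩, _,
            ⟨c, Metric.mem_closedBall'.2 hcd, rfl⟩, ?_⟩
          simp only [hc, ← hΨφ, ← map_add, add_sub_cancel]
        · rintro _ ⟨w, hw, _, ⟨c, -, rfl⟩, rfl⟩
          choose v hv using fun i => hw i trivial
          exact Ψ.range.add_mem ⟨φ v, by rw [hΨφ]; exact funext hv⟩ ⟨_, rfl⟩
      have htop : Ψ.range = ⊤ := by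
        refine addSubgroup_eq_top_of_isConnected ?_ ?_ ?_
        · rw [hsum]
          exact hΛ.add_right_of_isCompact ((isCompact_closedBall _ _).image hc)
        · rw [himage]
          exact isPreconnected_range hc
        · rw [← top_le_iff, ← (Pi.basisFun ℝ (Fin m)).span_eq, Submodule.span_le]
          rintro _ ⟨i, rfl⟩
          refine Submodule.subset_span ⟨φ (Pi.single i 1), ?_⟩
          rw [hΨφ]
          ext j
          by_cases hij : j = i
          · subst hij
            simp
          · simp [hij]
      intro w
      obtain ⟨q, hq⟩ : w.toAdd ∈ Ψ.range := by
        rw [htop]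
        trivial
      exact ⟨q.toMul, congrArg Multiplicative.ofAdd hq⟩
  · rw [← hker] at hn
    refine (coarseDimLE_preimage_range hinv hπs hn φ hφ).of_near (C := C) fun x _ => ?_
    obtain ⟨v, c, hc, hcd⟩ := hC (π x).toAdd
    refine ⟨x * c⁻¹, ⟨v, ?_⟩, ?_⟩
    · rw [map_mul, map_inv, toAdd_mul, toAdd_inv, hc]
      abel
    · rw [dist_eq_dist_one hinv, inv_mul_cancel_left, dist_one_inv hinv]
      exact hcd

end ProperGroup

section LieHirsch

theorem ConnectedCentralSeries.exists_coarseDimLE {N : Type u} [Group N] [MetricSpace N]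
    [ProperSpace N] [IsTopologicalGroup N]
    (hinv : ∀ a x y : N, dist (a * x) (a * y) = dist x y) (s : ConnectedCentralSeries N) :
    ∃ m : ℕ, (m : ℕ∞) ≤ s.realLength ∧ CoarseDimLE (Set.univ : Set N) m := by
  have key : ∀ i, ∃ m : ℕ, (m : ℕ∞) ≤ ∑ j ∈ Finset.range i,
      (haveI := s.normal j
       realRank (↥(s.term (j + 1)) ⧸ (s.term j).subgroupOf (s.term (j + 1)))) ∧
      CoarseDimLE (s.term i : Set N) m := by
    intro i
    induction i with
    | zero =>
      refine ⟨0, by simp, ?_⟩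
      rw [s.term_zero]
      simpa using coarseDimLE_singleton (1 : N)
    | succ i ih =>
      obtain ⟨m, hm, hdim⟩ := ih
      have := s.normal i
      have : ProperSpace (s.term (i + 1)) := ProperSpace.of_isClosed (s.isClosed (i + 1))
      have : ConnectedSpace (s.term (i + 1)) :=
        isConnected_iff_connectedSpace.1 (s.isConnected (i + 1))
      obtain ⟨k, hk, hstep⟩ := exists_realRank_bound (H := s.term (i + 1))
        (fun a x y => hinv a x y) ((s.term i).subgroupOf (s.term (i + 1))) (fun x y => by
          rw [Subgroup.mem_subgroupOf]
          exact s.central i (Subgroup.commutator_mem_commutator x.2 (Subgroup.mem_top (y : N))))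
      refine ⟨m + k, ?_, ?_⟩
      · rw [Finset.sum_range_succ]
        push_cast
        exact add_le_add hm hk
      · have h1 : CoarseDimLE ((s.term i).subgroupOf (s.term (i + 1)) :
            Set (s.term (i + 1))) m := fun r => by
          obtain ⟨D, hD⟩ := hdim (r + 0)
          exact ⟨_, hD.pullback Subtype.val (fun x hx => hx) fun x _ y _ => by
            rw [Subtype.dist_eq, sub_self, abs_zero]⟩
        intro r
        obtain ⟨D, hD⟩ := hstep m h1 (r + 0)
        classical
        refine ⟨_, hD.pullback (fun x : N => if hx : x ∈ s.term (i + 1) then ⟨x, hx⟩ else 1)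
          (fun _ _ => Set.mem_univ _) fun x hx y hy => ?_⟩
        rw [dif_pos (show x ∈ s.term (i + 1) from hx), dif_pos (show y ∈ s.term (i + 1) from hy),
          Subtype.dist_eq, sub_self, abs_zero]
  obtain ⟨m, hm, hdim⟩ := key s.length
  refine ⟨m, hm, ?_⟩
  rwa [s.term_length, Subgroup.coe_top] at hdim

theorem asdim_le_lieHirschLength {N : Type u} [Group N] [MetricSpace N]
    [ProperSpace N] [IsTopologicalGroup N]
    (hinv : ∀ a x y : N, dist (a * x) (a * y) = dist x y) : asdim N ≤ lieHirschLength N :=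
  le_iInf fun s => by
    obtain ⟨m, hm, hdim⟩ := s.exists_coarseDimLE hinv
    exact (asdim_le_of_coarseDimLE hdim).trans hm

end LieHirsch

theorem mainTheorem8 :
    -- finitely generated polycyclic groups
    (∀ (Γ : Type*) [Group Γ], IsPolycyclic Γ →
      ∀ (S : Set Γ) (_ : S.Finite) (hgen : Subgroup.closure S = ⊤) (hinv : ∀ s ∈ S, s⁻¹ ∈ S),
        asdimWord S hgen hinv ≤ hirschLength Γ) ∧
    -- finitely generated nilpotent groups
    (∀ (Γ : Type*) [Group Γ], Group.IsNilpotent Γ →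
      ∀ (S : Set Γ) (_ : S.Finite) (hgen : Subgroup.closure S = ⊤) (hinv : ∀ s ∈ S, s⁻¹ ∈ S),
        IsPolycyclic Γ ∧ asdimWord S hgen hinv ≤ hirschLength Γ) ∧
    -- connected nilpotent Lie groups with a proper left-invariant metric
    (∀ (E : Type*) [NormedAddCommGroup E] [NormedSpace ℝ E] [FiniteDimensional ℝ E]
      (N : Type*) [Group N] [MetricSpace N] [ProperSpace N] [ConnectedSpace N]
      [ChartedSpace E N] [LieGroup 𝓘(ℝ, E) ∞ N],
      Group.IsNilpotent N → (∀ a x y : N, dist (a * x) (a * y) = dist x y) →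
        Nonempty (ConnectedCentralSeries N) ∧ asdim N ≤ lieHirschLength N) := by
  refine ⟨fun Γ _ _ S hS hgen hinv => asdimWord_le_hirschLength hS hgen hinv,
    fun Γ _ hΓ S hS hgen hinv =>
      ⟨isPolycyclic_of_isNilpotent hS hgen, asdimWord_le_hirschLength hS hgen hinv⟩, ?_⟩
  intro E _ _ _ N _ _ _ _ _ _ hN hinv
  have : IsTopologicalGroup N := topologicalGroup_of_lieGroup 𝓘(ℝ, E) ∞
  exact ⟨nonempty_connectedCentralSeries, asdim_le_lieHirschLength hinv⟩
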